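/- \textbf{Setting.} There are $K$ arms. A gap matrix is $\Delta\in\mathbb R^{K\times K}$; arm $i$ is a Condorcet winner (CW) of $\Delta$ if $\Delta_{i,j}>0$ for all $j\ne i$. Let $\mathbb D_{\mathrm{cw}}$ be the set of antisymmetric matrices with entries in $[-\tfrac14,\tfrac14]$ that admit a CW. An algorithm $A$ adaptively (and possibly with randomization) chooses ordered pairs of arms to be compared, and may stop and recommend an arm $\hat\imath$. Conditionally on the past, a comparison of $(i,j)$ in the environment $\Delta$ returns an independent Bernoulli variable with parameter $\tfrac12+\Delta_{i,j}$. The budget $N\in\mathbb N\cup\{\infty\}$ is the number of comparisons made before stopping, and $\mathbb P_{\Delta,A}$ is the resulting law. The algorithm $A$ is $\delta$-correct if, for every $\Delta\in\mathbb D_{\mathrm{cw}}$ with CW $i^*$, it recommends an arm $\hat\imath\neq i^*$ with $\mathbb P_{\Delta,A}$-probability at most $\delta$. For a row $i$, let $K_{i;<0}=|\{j:\Delta_{i,j}<0\}|$, let $\Delta_{i,(1)}\le\dots\le\Delta_{i,(K_{i;<0})}<0$ be the ordered negative entries, and let $\|\Delta_i^-\|^2=\sum_j\min(\Delta_{i,j},0)^2$.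 For $\Delta\in\mathbb D_{\mathrm{cw}}$ with CW $i^*$, call $s=(s_i)_{i\ne i^*}$ an effective sparsity of $\Delta$ with cap $c\in\mathbb R$ if it minimizes $$\sum_{i\ne i^*}\frac{\log(1/\delta)}{\Delta_{i,(s_i)}^2}+\max_{i\ne i^*}\frac{K\log(1/\delta)}{s_i\Delta_{i,(s_i)}^2}+\sum_{i\ne i^*}\frac{K}{s_i\Delta_{i,(s_i)}^2}$$ over integers $1\le s_i\le K_{i;<0}\wedge c$. Let $\mathbb D_c(\Delta)$ be the set of $\tilde\Delta\in\mathbb D_{\mathrm{cw}}$ that have the same CW $i^*$ and the same effective sparsities with cap $c$ as $\Delta$, and that satisfy $\tilde\Delta_{i,(s_i)}=\Delta_{i,(s_i)}$ for each such $s$ and each $i\ne i^*$. (The choice $c=K/8$ gives the class $\mathbb D(\Delta)$; $c=K$ removes the cap.) \textbf{Theorem.} Let $0<\delta\le 1/12$, let $A$ be a $\delta$-correct algorithm, and let $\Delta\in\mathbb D_{\mathrm{cw}}$ with CW $i^*$ have no ties, i.e. $\Delta_{i,j}\neq0$ for all $i\ne j$. Then there are permutations $\pi_i$ of $\{1,\dots,K\}$,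 each mapping $\{j:\Delta_{i,j}<0\}$ onto itself, such that the matrix $\tilde\Delta$ given by $\tilde\Delta_{i,j}=\Delta_{i,\pi_i(j)}$ if $\Delta_{i,j}<0$, $\tilde\Delta_{i,j}=-\Delta_{j,\pi_j(i)}$ if $\Delta_{i,j}>0$, and $\tilde\Delta_{i,j}=0$ otherwise, has the following properties: it belongs to $\mathbb D_c(\Delta)$ for every $c$ (in particular to $\mathbb D(\Delta)$ and to $\mathbb D_{\mathrm{cw}}$, with CW $i^*$); it has the same signs as $\Delta$; in each row it has the same multiset of negative entries as $\Delta$; and $$\mathbb P_{\tilde\Delta,A}\!\left(N\ \ge\ \frac13\max_{i\ne i^*}\frac{K_{i;<0}}{\|\Delta_i^-\|^2}\,\log\frac1{6\delta}\ \vee\ \frac1{37\log(2K)}\sum_{i\ne i^*}\frac{K_{i;<0}}{\|\Delta_i^-\|^2}\right)\ \ge\ \delta .$$ (A maximum over the empty set, which occurs only for $K=1$, is $0$.) -/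

import Mathlib

open MeasureTheory ProbabilityTheory

noncomputable section

namespace DuelingBandit

/-! ### Environments -/

/-- Arm `i` is a Condorcet winner: it has a positive gap against every other arm. -/
def IsCondorcetWinner {K : ℕ} (Δ : Matrix (Fin K) (Fin K) ℝ) (i : Fin K) : Prop :=
  ∀ j, j ≠ i → 0 < Δ i j

/-- The class `𝔻_cw`: antisymmetric gap matrices with entries in `[-1/4, 1/4]` that admit a
Condorcet winner. -/
def Dcw (K : ℕ) : Set (Matrix (Fin K) (Fin K) ℝ) :=
  {Δ | (∀ i j, Δ i j ∈ Set.Icc (-1 / 4 : ℝ) (1 / 4)) ∧ Δ = -Δ.transpose ∧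
    ∃ i, IsCondorcetWinner Δ i}

/-! ### Algorithms and their interaction with an environment -/

/-- An observed duel: the ordered pair that was queried and the outcome
(`true` means that the first arm of the pair was preferred). -/
abbrev Duel (K : ℕ) : Type := (Fin K × Fin K) × Bool

/-- What happens in one round: a duel (`Sum.inl`), or the algorithm stops and recommends an arm
(`Sum.inr`). -/
abbrev Round (K : ℕ) : Type := Duel K ⊕ Fin K

instance (K : ℕ) : DiscreteMeasurableSpace (Round K) where
  forall_measurableSet _ := measurableSet_sum_iff.2 ⟨.of_discrete, .of_discrete⟩

/-- A (randomised, adaptive) algorithm: given the duels observed so far, it draws its next decision,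
which is either a pair to be compared or to stop and recommend an arm. -/
abbrev Algorithm (K : ℕ) : Type := List (Duel K) → PMF ((Fin K × Fin K) ⊕ Fin K)

/-- The law of the outcome of a duel with gap `x`: Bernoulli with parameter `1/2 + x`.
(The projection onto `[0, 1]` does nothing when `|x| ≤ 1/2`.) -/
def outcomeLaw (x : ℝ) : PMF Bool :=
  (bernoulliMeasure true false (Set.projIcc (0 : ℝ) 1 zero_le_one (1 / 2 + x))).toPMF

/-- The law of the next round, given the duels observed so far: the algorithm takes its decision
and, if this is a pair, the environment `Δ` draws the outcome of the duel. -/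
def roundLaw {K : ℕ} (A : Algorithm K) (Δ : Matrix (Fin K) (Fin K) ℝ) (h : List (Duel K)) :
    PMF (Round K) :=
  (A h).bind (Sum.elim (fun p => (outcomeLaw (Δ p.1 p.2)).map fun b => Sum.inl (p, b))
    (fun i => PMF.pure (Sum.inr i)))

/-- The duels among the rounds `0, …, n`, in chronological order. -/
def duels {K : ℕ} {n : ℕ} (x : (t : Finset.Iic n) → Round K) : List (Duel K) :=
  (List.ofFn fun t : Fin (n + 1) =>
    x ⟨t, Finset.mem_Iic.2 (Nat.lt_succ_iff.1 t.2)⟩).filterMap Sum.getLeft?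

/-- The transition kernel from the rounds `0, …, n` to the round `n + 1`. -/
def roundKernel {K : ℕ} (A : Algorithm K) (Δ : Matrix (Fin K) (Fin K) ℝ) (n : ℕ) :
    Kernel ((t : Finset.Iic n) → Round K) (Round K) where
  toFun x := (roundLaw A Δ (duels x)).toMeasure
  measurable' := .of_discrete

instance {K : ℕ} (A : Algorithm K) (Δ : Matrix (Fin K) (Fin K) ℝ) (n : ℕ) :
    IsMarkovKernel (roundKernel A Δ n) where
  isProbabilityMeasure x := by
    change IsProbabilityMeasure (roundLaw A Δ (duels x)).toMeasure
    infer_instance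

/-- The law `ℙ_{Δ,A}` of the sequence of rounds when `A` interacts with the environment `Δ`.
Whatever follows the first round in which `A` stops is irrelevant: neither `budget` nor
`recommendation` depends on it. -/
def law {K : ℕ} (A : Algorithm K) (Δ : Matrix (Fin K) (Fin K) ℝ) : Measure (ℕ → Round K) :=
  Kernel.trajMeasure (X := fun _ => Round K) (roundLaw A Δ []).toMeasure (roundKernel A Δ)

/-- The budget `N`: the number of duels before the algorithm stops (`⊤` if it never stops). -/
def budget {K : ℕ} (ω : ℕ → Round K) : ℕ∞ :=
  ⨅ (t : ℕ) (_ : (ω t).isRight = true), (t : ℕ∞)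

open Classical in
/-- The recommended arm (`none` if the algorithm never stops). -/
def recommendation {K : ℕ} (ω : ℕ → Round K) : Option (Fin K) :=
  if h : ∃ t, (ω t).isRight = true then (ω (Nat.find h)).getRight? else none

/-- `δ`-correctness on `𝔻_cw`: for every environment of the class, a wrong arm is recommended with
probability at most `δ`. -/
def IsDeltaCorrect {K : ℕ} (A : Algorithm K) (δ : ℝ) : Prop :=
  ∀ Δ ∈ Dcw K, ∀ istar, IsCondorcetWinner Δ istar →
    (law A Δ).real {ω | ∃ i, recommendation ω = some i ∧ i ≠ istar} ≤ δ

/-! ### Hardness parameters of a row -/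

/-- The multiset of the negative entries of row `i`. -/
def negEntries {K : ℕ} (Δ : Matrix (Fin K) (Fin K) ℝ) (i : Fin K) : Multiset ℝ :=
  (Finset.univ.filter fun j => Δ i j < 0).val.map (Δ i)

/-- `K_{i;<0}`, the number of negative entries of row `i`. -/
def numNeg {K : ℕ} (Δ : Matrix (Fin K) (Fin K) ℝ) (i : Fin K) : ℕ :=
  (Finset.univ.filter fun j => Δ i j < 0).card

/-- `‖Δ_i^-‖²`, where `Δ_{i,j}^- = min (Δ_{i,j}) 0`. -/
def sqNormNeg {K : ℕ} (Δ : Matrix (Fin K) (Fin K) ℝ) (i : Fin K) : ℝ :=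
  ∑ j, (min (Δ i j) 0) ^ 2

/-- `Δ_{i,(s)}`, the `s`-th smallest entry of row `i`, for `1 ≤ s ≤ K_{i;<0}`. -/
def ordEntry {K : ℕ} (Δ : Matrix (Fin K) (Fin K) ℝ) (i : Fin K) (s : ℕ) : ℝ :=
  (negEntries Δ i).sort.getD (s - 1) 0

/-! ### Effective sparsity and the local class `𝔻(Δ)` -/

/-- `H_certify(s, δ)`. -/
def Hcertify {K : ℕ} (Δ : Matrix (Fin K) (Fin K) ℝ) (istar : Fin K) (s : Fin K → ℕ) (δ : ℝ) : ℝ :=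
  ∑ i ∈ Finset.univ.erase istar, Real.log (1 / δ) / ordEntry Δ i (s i) ^ 2

/-- `H_explore(s, δ)`. -/
def Hexplore {K : ℕ} (Δ : Matrix (Fin K) (Fin K) ℝ) (istar : Fin K) (s : Fin K → ℕ) (δ : ℝ) : ℝ :=
  (⨆ i : {i // i ≠ istar}, K * Real.log (1 / δ) / (s i * ordEntry Δ i (s i) ^ 2)) +
    ∑ i ∈ Finset.univ.erase istar, K / (s i * ordEntry Δ i (s i) ^ 2)

/-- The admissible sparsities: `1 ≤ s_i ≤ K_{i;<0} ∧ c` for every suboptimal arm `i`. -/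
def IsAdmissible {K : ℕ} (c : ℝ) (Δ : Matrix (Fin K) (Fin K) ℝ) (istar : Fin K)
    (s : Fin K → ℕ) : Prop :=
  ∀ i, i ≠ istar → 1 ≤ s i ∧ s i ≤ numNeg Δ i ∧ (s i : ℝ) ≤ c

/-- `s` is an effective sparsity `s*` of `Δ`: it minimises `H_certify + H_explore` among the
admissible sparsities. -/
def IsEffectiveSparsity {K : ℕ} (c δ : ℝ) (Δ : Matrix (Fin K) (Fin K) ℝ) (istar : Fin K)
    (s : Fin K → ℕ) : Prop :=
  IsAdmissible c Δ istar s ∧ ∀ t, IsAdmissible c Δ istar t →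
    Hcertify Δ istar s δ + Hexplore Δ istar s δ ≤ Hcertify Δ istar t δ + Hexplore Δ istar t δ

/-- The local class `𝔻(Δ)` of the matrices of `𝔻_cw` with the same Condorcet winner `istar`, the
same effective sparsities, and the same gaps `(Δ_{i,(s*_i)})_{i ≠ istar}`. -/
def localClass {K : ℕ} (c δ : ℝ) (Δ : Matrix (Fin K) (Fin K) ℝ) (istar : Fin K) :
    Set (Matrix (Fin K) (Fin K) ℝ) :=
  {Δ' | Δ' ∈ Dcw K ∧ IsCondorcetWinner Δ' istar ∧
    (∀ s, IsEffectiveSparsity c δ Δ' istar s ↔ IsEffectiveSparsity c δ Δ istar s) ∧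
    ∀ s, IsEffectiveSparsity c δ Δ istar s →
      ∀ i, i ≠ istar → ordEntry Δ' i (s i) = ordEntry Δ i (s i)}

/-! ### Row-wise permutations of the negative entries -/

/-- The matrix obtained from `Δ` by permuting the negative entries of each row `i` according to
`π i`, the positive entries being adapted so that the matrix remains antisymmetric. -/
def permuteNeg {K : ℕ} (Δ : Matrix (Fin K) (Fin K) ℝ) (π : Fin K → Equiv.Perm (Fin K)) :
    Matrix (Fin K) (Fin K) ℝ :=
  fun i j => if Δ i j < 0 then Δ i (π i j) else if 0 < Δ i j then -Δ j (π j i) else Δ i j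

/-- The lower bound on the budget:
`(1/3) max_{i ≠ istar} K_{i;<0}/‖Δ_i^-‖² log(1/(6δ)) ∨ 1/(37 log(2K)) ∑_{i ≠ istar} K_{i;<0}/‖Δ_i^-‖²`. -/
def budgetLowerBound {K : ℕ} (δ : ℝ) (Δ : Matrix (Fin K) (Fin K) ℝ) (istar : Fin K) : ℝ :=
  max (1 / 3 * (⨆ i : {i // i ≠ istar}, numNeg Δ i / sqNormNeg Δ i) * Real.log (1 / (6 * δ)))
    (1 / (37 * Real.log (2 * K)) *
      ∑ i ∈ Finset.univ.erase istar, numNeg Δ i / sqNormNeg Δ i)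

end DuelingBandit

end

/-!
# A lower bound on the budget, up to permutations of the losses of each arm

Call a pair of arms *informative for `i`* if `i` is its loser in `Δ` (`losingPairs`); since `Δ` is
antisymmetric, a pair is informative for at most one arm. Let `i` be a suboptimal arm and permute the negative
entries of its row uniformly at random. Compare the resulting environments with the one in which
these entries are erased (`raiseRow _ i 0`), which does not depend on the permutation.

* The erased environment is a limit of environments won by `i`. The probability that the
  algorithm stops within a given time, before a given number `k` of informative duels, with a
  recommendation other than `i` is a polynomial in the gaps (`stopVal`, `continuous_stopVal`).
  Hence it is at most `δ` in the erased environment (`stopVal_raiseRow_le`).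
* Each informative duel separates the erased environment from a permuted one by a divergence of at
  most `8/3` times the square of the gap. This square averages to `‖Δ_i^-‖² / K_{i;<0}`, whichever
  informative pair is chosen (`sum_env_sq`), and fewer than `k` informative duels matter. So the
  affinity between the erased law and the mixture of the permuted laws, restricted to the event
  above, is at least `exp (-(4/3) (k - 1) ‖Δ_i^-‖² / K_{i;<0})`. This is proved by induction along
  the tree of histories (`exp_neg_cost_le_affinity`), followed by Jensen's inequality
  (`exp_le_affinity_average`).
* In a permuted environment `i` must not be recommended. So if the event fails, then up to
  probability `δ` the budget is large or `k` informative duels take place (`one_le_stopVal_add`).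

Suppose that the budget is small with probability more than `1 - δ` for all the permutations. Taking
for `k` the claimed bound itself, `k` informative duels exceed the budget and the affinity gives
`√(6δ) ≤ √δ + √(2δ)`, which is false: this is the term with the maximum
(`exists_budgetProb_certify`). Taking `k` about `K_{i;<0} / (10 ‖Δ_i^-‖²)`, each suboptimal `i`
undergoes `k` informative duels with probability at least `7/25`, on average over the permutations
of all the rows (`mean_exploreEvent_ge`). As the informative pairs of distinct arms are disjoint,
these numbers add up to at most the budget, which gives the term with the sum
(`exists_budgetProb_explore`).

All the permuted environments belong to the local class, because effective sparsities depend only on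
the multisets of negative entries of the rows (`permuteNeg_mem_localClass`).
-/

noncomputable section

namespace DuelingBandit

/-! ### One-step description of the law -/

/-- The probability of the outcome `b` in a duel with gap `x`, as a polynomial in `x`; it agrees
with `outcomeLaw` as long as `|x| ≤ 1/2`. -/
def outcomeProb (x : ℝ) (b : Bool) : ℝ := if b then 1 / 2 + x else 1 / 2 - x

lemma sum_outcomeProb (x : ℝ) : ∑ b, outcomeProb x b = 1 := by
  simp [outcomeProb]; ring

lemma toReal_outcomeLaw {x : ℝ} (hx : x ∈ Set.Icc (-1 / 4 : ℝ) (1 / 4)) (b : Bool) :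
    (outcomeLaw x b).toReal = outcomeProb x b := by
  have h : (1 / 2 + x) ∈ Set.Icc (0 : ℝ) 1 := by constructor <;> linarith [hx.1, hx.2]
  have hp : ((Set.projIcc (0 : ℝ) 1 zero_le_one (1 / 2 + x) : unitInterval) : ℝ) = 1 / 2 + x := by
    rw [Set.projIcc_of_mem _ h]
  rw [outcomeLaw, Measure.toPMF_apply, ← measureReal_def]
  cases b
  · rw [bernoulliMeasure_real_apply_of_notMem_of_mem _ (by simp) (by simp) (by simp), hp]
    simp [outcomeProb]; ring
  · rw [bernoulliMeasure_real_apply_of_mem_of_notMem _ (by simp) (by simp) (by simp), hp]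
    simp [outcomeProb]

variable {K : ℕ}

lemma roundLaw_inr (A : Algorithm K) (Δ : Matrix (Fin K) (Fin K) ℝ) (h : List (Duel K))
    (a : Fin K) : roundLaw A Δ h (Sum.inr a) = A h (Sum.inr a) := by
  classical
  rw [roundLaw, PMF.bind_apply, tsum_fintype, Fintype.sum_sum_type]
  simp [PMF.map_apply, PMF.pure_apply]

lemma roundLaw_inl (A : Algorithm K) (Δ : Matrix (Fin K) (Fin K) ℝ) (h : List (Duel K))
    (p : Fin K × Fin K) (b : Bool) :
    roundLaw A Δ h (Sum.inl (p, b)) = A h (Sum.inl p) * outcomeLaw (Δ p.1 p.2) b := by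
  classical
  rw [roundLaw, PMF.bind_apply, tsum_fintype, Fintype.sum_sum_type, Finset.sum_eq_single p]
  · simp [PMF.map_apply, PMF.pure_apply]
  · intro q _ hq
    have : ∀ c, ¬(p = q ∧ b = c) := fun c hc => hq hc.1.symm
    simp [PMF.map_apply, this]
  · simp

lemma filterMap_getLeft?_map_inl {α β : Type*} (l : List α) :
    (l.map (Sum.inl : α → α ⊕ β)).filterMap Sum.getLeft? = l := by
  induction l with
  | nil => rfl
  | cons a l ih => simpa using ih

/-- The duels among the rounds `0, …, t - 1`. -/
def hist (ω : ℕ → Round K) (t : ℕ) : List (Duel K) :=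
  (List.ofFn fun s : Fin t => ω s).filterMap Sum.getLeft?

/-- The trajectories whose first rounds are exactly the duels of the list `l`. -/
def cylinderOf (l : List (Duel K)) : Set (ℕ → Round K) :=
  {ω | ∀ s (hs : s < l.length), ω s = Sum.inl l[s]}

lemma hist_of_mem_cylinderOf {l : List (Duel K)} {ω : ℕ → Round K} (hω : ω ∈ cylinderOf l) :
    hist ω l.length = l := by
  have : (List.ofFn fun s : Fin l.length => ω s) = l.map Sum.inl := by
    apply List.ext_getElem <;> simp
    intro s hs
    exact hω s hs
  rw [hist, this, filterMap_getLeft?_map_inl]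

lemma measurable_eval_round (n : ℕ) : Measurable fun ω : ℕ → Round K => ω n :=
  measurable_pi_apply n

instance (A : Algorithm K) (Δ : Matrix (Fin K) (Fin K) ℝ) : IsProbabilityMeasure (law A Δ) := by
  unfold law; infer_instance

lemma law_map_eval_zero (A : Algorithm K) (Δ : Matrix (Fin K) (Fin K) ℝ) :
    (law A Δ).map (fun ω => ω 0) = (roundLaw A Δ []).toMeasure := by
  have h0 : (fun ω : ℕ → Round K => ω 0) =
      (MeasurableEquiv.piUnique (fun _ : Finset.Iic 0 => Round K)) ∘
        (Preorder.frestrictLe (π := fun _ => Round K) 0) := rfl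
  rw [h0, ← Measure.map_map (MeasurableEquiv.measurable _) (by fun_prop), law,
    Kernel.trajMeasure, Measure.map_comp _ _ (by fun_prop), Kernel.traj_map_frestrictLe,
    Kernel.partialTraj_self, Measure.id_comp, Measure.map_map (MeasurableEquiv.measurable _)
      (MeasurableEquiv.measurable _), MeasurableEquiv.self_comp_symm, Measure.map_id]

/-- Conditionally on having observed the duels `l`, the next round has law `roundLaw A Δ l`. -/
lemma law_cylinderOf_inter (A : Algorithm K) (Δ : Matrix (Fin K) (Fin K) ℝ)
    (l : List (Duel K)) (r : Round K) :
    (law A Δ).real (cylinderOf l ∩ {ω | ω l.length = r}) =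
      (law A Δ).real (cylinderOf l) * (roundLaw A Δ l r).toReal := by
  rcases Nat.eq_zero_or_pos l.length with hl | hl
  · obtain rfl := List.eq_nil_of_length_eq_zero hl
    have h1 : cylinderOf ([] : List (Duel K)) = Set.univ := by ext; simp [cylinderOf]
    have h2 : {ω : ℕ → Round K | ω 0 = r} = (fun ω => ω 0) ⁻¹' {r} := rfl
    rw [h1, Set.univ_inter, List.length_nil, probReal_univ, one_mul, h2,
      ← map_measureReal_apply (measurable_eval_round 0) .of_discrete, law_map_eval_zero,
      measureReal_def, PMF.toMeasure_apply_singleton _ _ .of_discrete]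
  · obtain ⟨n, hn⟩ : ∃ n, l.length = n + 1 := ⟨l.length - 1, by omega⟩
    let x : (t : Finset.Iic n) → Round K := fun t => Sum.inl (l[t.1]'(by
      have := Finset.mem_Iic.1 t.2; omega))
    have hx : duels x = l := by
      have : (List.ofFn fun t : Fin (n + 1) =>
          x ⟨t, Finset.mem_Iic.2 (Nat.lt_succ_iff.1 t.2)⟩) = l.map Sum.inl := by
        apply List.ext_getElem
        · simp [hn]
        · intro s h₁ h₂
          simp only [List.getElem_ofFn, List.getElem_map, x]
      rw [duels, this, filterMap_getLeft?_map_inl]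
    have hc : cylinderOf l =
        (Preorder.frestrictLe (π := fun _ => Round K) n) ⁻¹' {x} := by
      ext ω
      simp only [cylinderOf, Set.mem_ofPred_eq, Set.mem_preimage, Set.mem_singleton_iff,
        funext_iff, Preorder.frestrictLe_apply, Subtype.forall, Finset.mem_Iic, x, hn,
        Nat.lt_succ_iff]
    have hm : Measurable (Preorder.frestrictLe (π := fun _ => Round K) n) := by fun_prop
    have hm2 : Measurable (fun ω : ℕ → Round K =>
      (Preorder.frestrictLe (π := fun _ => Round K) n ω, ω (n + 1))) := by fun_prop
    have key := Kernel.map_frestrictLe_trajMeasure_compProd_eq_map_trajMeasure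
      (X := fun _ => Round K) (μ₀ := (roundLaw A Δ []).toMeasure) (κ := roundKernel A Δ) (a := n)
    have hs : cylinderOf l ∩ {ω | ω l.length = r} = (fun ω : ℕ → Round K =>
      (Preorder.frestrictLe (π := fun _ => Round K) n ω, ω (n + 1))) ⁻¹' ({x} ×ˢ {r}) := by
      rw [hc, hn]; rfl
    have hk := congrArg (fun μ : Measure _ => μ.real ({x} ×ˢ {r})) key
    rw [map_measureReal_apply hm2 ((MeasurableSet.singleton x).prod .of_discrete)] at hk
    rw [hs, law, ← hk, measureReal_def, Measure.compProd_apply_prod (.singleton _) .of_discrete,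
      lintegral_singleton, ENNReal.toReal_mul, mul_comm, ← measureReal_def,
      map_measureReal_apply hm (.singleton _), hc]
    congr 2
    change (roundLaw A Δ (duels x)).toMeasure {r} = _
    rw [PMF.toMeasure_apply_singleton _ _ .of_discrete, hx]


/-! ### Stopping events and their probabilities as tree recursions -/

/-- The event that the algorithm first stops at some round `n ≤ t < n + m`, and that
the observed duels and the recommended arm then satisfy `P`. -/
def stopEventFrom (n m : ℕ) (P : List (Duel K) → Fin K → Prop) : Set (ℕ → Round K) :=
  {ω | ∃ t, n ≤ t ∧ t < n + m ∧ ∃ a, (∀ s < t, (ω s).isLeft) ∧ ω t = Sum.inr a ∧ P (hist ω t) a}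

/-- The event that the budget is less than `m`, and that the observed duels and the
recommended arm satisfy `P`. -/
abbrev stopEvent (m : ℕ) (P : List (Duel K) → Fin K → Prop) : Set (ℕ → Round K) :=
  stopEventFrom 0 m P

open Classical in
/-- The probability that, after the duels `h`, the algorithm stops within the next `m` rounds with
a final history and a recommendation that satisfy `P`. It is computed by recursion on the tree of
histories and is a polynomial in the entries of `Δ`. -/
def stopVal (A : Algorithm K) (Δ : Matrix (Fin K) (Fin K) ℝ) (P : List (Duel K) → Fin K → Prop) :
    ℕ → List (Duel K) → ℝ
  | 0, _ => 0
  | m + 1, h => ∑ a, (A h (Sum.inr a)).toReal * (if P h a then 1 else 0) +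
      ∑ p : Fin K × Fin K, (A h (Sum.inl p)).toReal *
        ∑ b, outcomeProb (Δ p.1 p.2) b * stopVal A Δ P m (h ++ [(p, b)])

lemma hist_congr {ω ω' : ℕ → Round K} {t : ℕ} (h : ∀ s < t, ω s = ω' s) :
    hist ω t = hist ω' t := by
  unfold hist
  congr 2
  funext s
  exact h s s.2

lemma length_hist_le (ω : ℕ → Round K) (t : ℕ) : (hist ω t).length ≤ t :=
  (List.length_filterMap_le _ _).trans (by simp)

/-- Events that depend on finitely many rounds are measurable. -/
lemma measurableSet_of_dependsOn {S : Set (ℕ → Round K)} (n : ℕ)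
    (hS : ∀ ω ω' : ℕ → Round K, (∀ s < n, ω s = ω' s) → ω ∈ S → ω' ∈ S) : MeasurableSet S := by
  let f : (ℕ → Round K) → (Fin n → Round K) := fun ω s => ω s
  have hf : Measurable f := by fun_prop
  have : S = f ⁻¹' (f '' S) := by
    refine (Set.subset_preimage_image f S).antisymm ?_
    rintro ω ⟨ω', hω', h⟩
    exact hS ω' ω (fun s hs => congrFun h ⟨s, hs⟩) hω'
  rw [this]
  exact hf .of_discrete

lemma measurableSet_stopEventFrom (n m : ℕ) (P : List (Duel K) → Fin K → Prop) :
    MeasurableSet (stopEventFrom n m P) := by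
  refine measurableSet_of_dependsOn (n + m) ?_
  rintro ω ω' h ⟨t, hnt, ht, a, hl, hr, hP⟩
  have h' : ∀ s ≤ t, ω s = ω' s := fun s hs => h s (by omega)
  refine ⟨t, hnt, ht, a, fun s hs => h' s hs.le ▸ hl s hs, h' t le_rfl ▸ hr, ?_⟩
  rwa [← hist_congr fun s hs => h' s hs.le]

lemma cylinderOf_inter_eval (l : List (Duel K)) (d : Duel K) :
    cylinderOf l ∩ {ω | ω l.length = Sum.inl d} = cylinderOf (l ++ [d]) := by
  ext ω
  simp only [cylinderOf, Set.mem_inter_iff, Set.mem_ofPred_eq, List.length_append,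
    List.length_singleton]
  constructor
  · rintro ⟨h1, h2⟩ s hs
    rcases (Nat.lt_succ_iff.1 hs).lt_or_eq with h | rfl
    · rw [h1 s h, List.getElem_append_left h]
    · simpa using h2
  · intro h
    refine ⟨fun s hs => ?_, ?_⟩
    · rw [h s (by omega), List.getElem_append_left hs]
    · simpa using h l.length (by omega)

lemma sum_measureReal_inter_eval (μ : Measure (ℕ → Round K)) [IsFiniteMeasure μ] (n : ℕ)
    (S : Set (ℕ → Round K)) : ∑ r, μ.real (S ∩ {ω | ω n = r}) = μ.real S := by
  have := sum_measureReal_preimage_singleton (μ := μ.restrict S) Finset.univ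
    (f := fun ω : ℕ → Round K => ω n) (fun r _ => measurable_eval_round n .of_discrete)
  rw [Finset.coe_univ, Set.preimage_univ, measureReal_restrict_apply_univ] at this
  rw [← this]
  refine Finset.sum_congr rfl fun r _ => ?_
  rw [measureReal_restrict_apply (measurable_eval_round n .of_discrete), Set.inter_comm]
  rfl

lemma law_cylinderOf_inter_stopEventFrom (A : Algorithm K) {Δ : Matrix (Fin K) (Fin K) ℝ}
    (hΔ : ∀ i j, Δ i j ∈ Set.Icc (-1 / 4 : ℝ) (1 / 4)) (P : List (Duel K) → Fin K → Prop)
    (m : ℕ) (l : List (Duel K)) :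
    (law A Δ).real (cylinderOf l ∩ stopEventFrom l.length m P) =
      (law A Δ).real (cylinderOf l) * stopVal A Δ P m l := by
  classical
  induction m generalizing l with
  | zero =>
    have : stopEventFrom l.length 0 P = ∅ := by
      ext ω
      simp only [stopEventFrom, Set.mem_ofPred_eq, Set.mem_empty_iff_false, iff_false]
      rintro ⟨t, h1, h2, -⟩
      omega
    simp [stopVal, this]
  | succ m ih =>
    have hr (a : Fin K) : cylinderOf l ∩ stopEventFrom l.length (m + 1) P ∩
        {ω | ω l.length = Sum.inr a} =
        if P l a then cylinderOf l ∩ {ω | ω l.length = Sum.inr a} else ∅ := by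
      ext ω
      constructor
      · rintro ⟨⟨hc, t, h1, h2, a', hl, ht, hP⟩, ha⟩
        rw [Set.mem_ofPred_eq] at ha
        have htl : t = l.length := by
          by_contra hne
          have := hl l.length (by omega)
          rw [ha] at this
          simp at this
        subst htl
        rw [ha] at ht
        obtain rfl := Sum.inr_injective ht
        rw [hist_of_mem_cylinderOf hc] at hP
        rw [if_pos hP]
        exact ⟨hc, ha⟩
      · intro h
        split_ifs at h with hP
        · refine ⟨⟨h.1, l.length, le_rfl, by omega, a, ?_, h.2, ?_⟩, h.2⟩
          · intro s hs
            rw [h.1 s hs]; rfl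
          · rwa [hist_of_mem_cylinderOf h.1]
        · exact h.elim
    have hl (d : Duel K) : cylinderOf l ∩ stopEventFrom l.length (m + 1) P ∩
        {ω | ω l.length = Sum.inl d} =
        cylinderOf (l ++ [d]) ∩ stopEventFrom (l ++ [d]).length m P := by
      rw [← cylinderOf_inter_eval, List.length_append, List.length_singleton]
      ext ω
      constructor
      · rintro ⟨⟨hc, t, h1, h2, a', hl, ht, hP⟩, ha⟩
        refine ⟨⟨hc, ha⟩, t, ?_, by omega, a', hl, ht, hP⟩
        rcases h1.lt_or_eq with h | h
        · exact h
        · subst h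
          rw [Set.mem_ofPred_eq, ht] at ha
          cases ha
      · rintro ⟨⟨hc, ha⟩, t, h1, h2, h3⟩
        exact ⟨⟨hc, t, by omega, by omega, h3⟩, ha⟩
    rw [← sum_measureReal_inter_eval _ l.length, Fintype.sum_sum_type, add_comm, stopVal, mul_add]
    congr 1
    · rw [Finset.mul_sum]
      refine Finset.sum_congr rfl fun a _ => ?_
      rw [hr]
      split_ifs
      · rw [law_cylinderOf_inter, roundLaw_inr, mul_one]
      · simp
    · rw [Fintype.sum_prod_type, Finset.mul_sum]
      refine Finset.sum_congr rfl fun p _ => ?_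
      rw [Finset.mul_sum, Finset.mul_sum]
      refine Finset.sum_congr rfl fun b _ => ?_
      rw [hl, ih, ← cylinderOf_inter_eval, law_cylinderOf_inter, roundLaw_inl, ENNReal.toReal_mul,
        toReal_outcomeLaw (hΔ _ _)]
      ring

/-- The probability of a stopping event is the value of the tree recursion at the root. -/
lemma law_stopEvent (A : Algorithm K) {Δ : Matrix (Fin K) (Fin K) ℝ}
    (hΔ : ∀ i j, Δ i j ∈ Set.Icc (-1 / 4 : ℝ) (1 / 4)) (P : List (Duel K) → Fin K → Prop)
    (m : ℕ) : (law A Δ).real (stopEvent m P) = stopVal A Δ P m [] := by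
  have h := law_cylinderOf_inter_stopEventFrom A hΔ P m []
  have h1 : cylinderOf ([] : List (Duel K)) = Set.univ := by ext; simp [cylinderOf]
  simpa [h1] using h

lemma continuous_stopVal (A : Algorithm K) (P : List (Duel K) → Fin K → Prop) (m : ℕ)
    (h : List (Duel K)) : Continuous fun Δ => stopVal A Δ P m h := by
  induction m generalizing h with
  | zero => simpa [stopVal] using continuous_const
  | succ m ih =>
    have hb : ∀ b : Bool, Continuous fun x => outcomeProb x b := by
      intro b; cases b <;> simp [outcomeProb] <;> fun_prop
    simp only [stopVal]
    refine continuous_const.add (continuous_finsetSum _ fun p _ => continuous_const.mul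
      (continuous_finsetSum _ fun b _ => Continuous.mul ?_ (ih _)))
    exact (hb b).comp (by fun_prop)

/-! ### Budget and recommendation on stopping events -/

lemma exists_first_stop {ω : ℕ → Round K} {b : ℝ}
    (h : ¬ ENNReal.ofReal b ≤ (budget ω : ENNReal)) :
    ∃ t < ⌈b⌉₊, ∃ a, (∀ s < t, (ω s).isLeft) ∧ ω t = Sum.inr a := by
  classical
  have hex : ∃ t, (ω t).isRight = true ∧ (t : ℝ) < b := by
    by_contra hcon
    push Not at hcon
    apply h
    have hB : ((⌈b⌉₊ : ℕ) : ℕ∞) ≤ budget ω := by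
      refine le_iInf₂ fun t ht => ?_
      exact_mod_cast Nat.ceil_le.2 (hcon t ht)
    calc ENNReal.ofReal b ≤ ENNReal.ofReal (⌈b⌉₊ : ℝ) := ENNReal.ofReal_le_ofReal (Nat.le_ceil b)
      _ = ((⌈b⌉₊ : ℕ∞) : ENNReal) := by simp
      _ ≤ _ := by exact_mod_cast hB
  have hex' : ∃ t, (ω t).isRight = true := ⟨_, hex.choose_spec.1⟩
  refine ⟨Nat.find hex', ?_, ?_⟩
  · obtain ⟨t, ht, htb⟩ := hex
    exact (Nat.find_min' hex' ht).trans_lt (Nat.lt_ceil.2 htb)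
  · obtain ⟨a, ha⟩ := Sum.isRight_iff.1 (Nat.find_spec hex')
    exact ⟨a, fun s hs => by simpa using Nat.find_min hex' hs, ha⟩

lemma recommendation_eq {ω : ℕ → Round K} {t : ℕ} {a : Fin K} (h : ∀ s < t, (ω s).isLeft)
    (ha : ω t = Sum.inr a) : recommendation ω = some a := by
  classical
  have hex : ∃ t, (ω t).isRight = true := ⟨t, by simp [ha]⟩
  have hf : Nat.find hex = t := by
    rw [Nat.find_eq_iff]
    exact ⟨by simp [ha], fun s hs => by simpa using h s hs⟩
  rw [recommendation, dif_pos hex, hf, ha]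
  rfl


/-! ### Affinity between two environments -/

/-- The Bhattacharyya affinity of two Bernoulli laws with parameters `u` and `v`. -/
def affinity (u v : ℝ) : ℝ := √(u * v) + √((1 - u) * (1 - v))

/-- Data processing for the affinity: a mixture is at least as hard to distinguish as its
components together with the mixing index. -/
lemma sum_sqrt_mul_affinity_le {ι : Type*} [Fintype ι] {w₀ w₁ u v : ι → ℝ}
    (hw₀ : ∀ i, 0 ≤ w₀ i) (hw₁ : ∀ i, 0 ≤ w₁ i) (h₀ : ∑ i, w₀ i = 1) (h₁ : ∑ i, w₁ i = 1)
    (hu : ∀ i, u i ∈ Set.Icc (0 : ℝ) 1) (hv : ∀ i, v i ∈ Set.Icc (0 : ℝ) 1) :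
    ∑ i, √(w₀ i * w₁ i) * affinity (u i) (v i) ≤ affinity (∑ i, w₀ i * u i) (∑ i, w₁ i * v i) := by
  have cs {x y : ι → ℝ} (hx : ∀ i, 0 ≤ x i) (hy : ∀ i, 0 ≤ y i) :
      ∑ i, √(w₀ i * w₁ i) * √(x i * y i) ≤ √((∑ i, w₀ i * x i) * ∑ i, w₁ i * y i) := by
    have hx' : ∀ i, 0 ≤ w₀ i * x i := fun i => mul_nonneg (hw₀ i) (hx i)
    have hy' : ∀ i, 0 ≤ w₁ i * y i := fun i => mul_nonneg (hw₁ i) (hy i)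
    rw [Real.sqrt_mul (Finset.sum_nonneg fun i _ => hx' i)]
    refine le_trans (le_of_eq ?_) (Real.sum_sqrt_mul_sqrt_le Finset.univ hx' hy')
    refine Finset.sum_congr rfl fun i _ => ?_
    rw [← Real.sqrt_mul (mul_nonneg (hw₀ i) (hw₁ i)), ← Real.sqrt_mul (hx' i)]
    congr 1; ring
  have e₀ : 1 - ∑ i, w₀ i * u i = ∑ i, w₀ i * (1 - u i) := by
    simp only [mul_sub, mul_one, Finset.sum_sub_distrib, h₀]
  have e₁ : 1 - ∑ i, w₁ i * v i = ∑ i, w₁ i * (1 - v i) := by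
    simp only [mul_sub, mul_one, Finset.sum_sub_distrib, h₁]
  simp only [affinity, mul_add, Finset.sum_add_distrib]
  rw [e₀, e₁]
  exact add_le_add (cs (fun i => (hu i).1) fun i => (hv i).1)
    (cs (fun i => sub_nonneg.2 (hu i).2) fun i => sub_nonneg.2 (hv i).2)

/-- One step of the change of measure: `d` is the logarithm of the likelihood ratio `w₀ / w₁` of the
two mixing laws, and `C` bounds the divergences of the components. -/
lemma exp_le_affinity_sum {ι : Type*} [Fintype ι] {w₀ w₁ u v d C : ι → ℝ}
    (hw₀ : ∀ i, 0 ≤ w₀ i) (hw₁ : ∀ i, 0 ≤ w₁ i) (h₀ : ∑ i, w₀ i = 1) (h₁ : ∑ i, w₁ i = 1)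
    (hu : ∀ i, u i ∈ Set.Icc (0 : ℝ) 1) (hv : ∀ i, v i ∈ Set.Icc (0 : ℝ) 1)
    (hd : ∀ i, √(w₀ i * w₁ i) = w₀ i * Real.exp (-(1 / 2) * d i))
    (hC : ∀ i, Real.exp (-(1 / 2) * C i) ≤ affinity (u i) (v i)) :
    Real.exp (-(1 / 2) * ∑ i, w₀ i * (d i + C i)) ≤
      affinity (∑ i, w₀ i * u i) (∑ i, w₁ i * v i) := by
  refine le_trans ?_ (sum_sqrt_mul_affinity_le hw₀ hw₁ h₀ h₁ hu hv)
  have hJ := convexOn_exp.map_sum_le (t := Finset.univ) (w := w₀)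
    (p := fun i => -(1 / 2) * (d i + C i)) (fun i _ => hw₀ i) h₀ (fun i _ => Set.mem_univ _)
  simp only [smul_eq_mul] at hJ
  have e : -(1 / 2) * ∑ i, w₀ i * (d i + C i) = ∑ i, w₀ i * (-(1 / 2) * (d i + C i)) := by
    rw [Finset.mul_sum]; exact Finset.sum_congr rfl fun i _ => by ring
  rw [e]
  refine hJ.trans (Finset.sum_le_sum fun i _ => ?_)
  rw [hd, mul_add, Real.exp_add, ← mul_assoc]
  exact mul_le_mul_of_nonneg_left (hC i) (mul_nonneg (hw₀ i) (Real.exp_nonneg _))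

lemma outcomeProb_nonneg {x : ℝ} (hx : x ∈ Set.Icc (-1 / 4 : ℝ) (1 / 4)) (b : Bool) :
    0 ≤ outcomeProb x b := by
  cases b <;> simp [outcomeProb] <;> linarith [hx.1, hx.2]

lemma sum_mul_mem_Icc {ι : Type*} [Fintype ι] {w u : ι → ℝ} (hw : ∀ i, 0 ≤ w i)
    (h1 : ∑ i, w i = 1) (hu : ∀ i, u i ∈ Set.Icc (0 : ℝ) 1) :
    ∑ i, w i * u i ∈ Set.Icc (0 : ℝ) 1 := by
  refine ⟨Finset.sum_nonneg fun i _ => mul_nonneg (hw i) (hu i).1, h1 ▸ ?_⟩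
  exact Finset.sum_le_sum fun i _ => mul_le_of_le_one_right (hw i) (hu i).2

lemma sum_outcome_mem_Icc {x : ℝ} (hx : x ∈ Set.Icc (-1 / 4 : ℝ) (1 / 4)) {u : Bool → ℝ}
    (hu : ∀ b, u b ∈ Set.Icc (0 : ℝ) 1) : ∑ b, outcomeProb x b * u b ∈ Set.Icc (0 : ℝ) 1 :=
  sum_mul_mem_Icc (outcomeProb_nonneg hx) (sum_outcomeProb x) hu

open Classical in
/-- The recursion of `stopVal`, with the two kinds of decisions gathered in one sum. -/
lemma stopVal_succ (A : Algorithm K) (Δ : Matrix (Fin K) (Fin K) ℝ)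
    (P : List (Duel K) → Fin K → Prop) (m : ℕ) (h : List (Duel K)) :
    stopVal A Δ P (m + 1) h = ∑ d, (A h d).toReal * Sum.elim
      (fun p : Fin K × Fin K =>
        ∑ b, outcomeProb (Δ p.1 p.2) b * stopVal A Δ P m (h ++ [(p, b)]))
      (fun a => if P h a then 1 else 0) d := by
  rw [stopVal, Fintype.sum_sum_type, add_comm]
  rfl

lemma sum_toReal_decision (A : Algorithm K) (h : List (Duel K)) : ∑ d, (A h d).toReal = 1 := by
  have h2 := congrArg ENNReal.toReal (A h).tsum_coe
  rw [tsum_fintype, ENNReal.toReal_sum (fun d _ => (A h).apply_ne_top d)] at h2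
  simpa using h2

lemma stopVal_mem_Icc (A : Algorithm K) {Δ : Matrix (Fin K) (Fin K) ℝ}
    (hΔ : ∀ i j, Δ i j ∈ Set.Icc (-1 / 4 : ℝ) (1 / 4)) (P : List (Duel K) → Fin K → Prop)
    (m : ℕ) (h : List (Duel K)) : stopVal A Δ P m h ∈ Set.Icc (0 : ℝ) 1 := by
  induction m generalizing h with
  | zero => simp [stopVal]
  | succ m ih =>
    rw [stopVal_succ]
    refine sum_mul_mem_Icc (fun _ => ENNReal.toReal_nonneg) (sum_toReal_decision A h) ?_
    rintro (p | a)
    · exact sum_outcome_mem_Icc (hΔ _ _) fun b => ih _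
    · simp only [Sum.elim_inr]; split_ifs <;> simp

/-- The number of duels of the history `h` between a pair of arms in `O`. -/
def countIn (O : Finset (Fin K × Fin K)) (h : List (Duel K)) : ℕ := h.countP fun d => d.1 ∈ O

lemma countIn_append (O : Finset (Fin K × Fin K)) (h : List (Duel K)) (p : Fin K × Fin K)
    (b : Bool) : countIn O (h ++ [(p, b)]) = countIn O h + if p ∈ O then 1 else 0 := by
  simp [countIn, List.countP_cons]

/-- The expected sum, in the environment `Δ`, of the costs `c p` of the duels `p ∈ O` among the next
`m` rounds after the duels `h`. The `k`-th duel in `O` and later ones are free: an event that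
requires fewer than `k` duels in `O` does not depend on their outcomes. -/
def cost (A : Algorithm K) (Δ : Matrix (Fin K) (Fin K) ℝ) (O : Finset (Fin K × Fin K))
    (c : Fin K × Fin K → ℝ) (k : ℕ) : ℕ → List (Duel K) → ℝ
  | 0, _ => 0
  | m + 1, h => ∑ p : Fin K × Fin K, (A h (Sum.inl p)).toReal *
      ((if p ∈ O ∧ countIn O h + 1 < k then c p else 0) +
        ∑ b, outcomeProb (Δ p.1 p.2) b * cost A Δ O c k m (h ++ [(p, b)]))

lemma stopVal_eq_zero (A : Algorithm K) (Δ : Matrix (Fin K) (Fin K) ℝ)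
    {P : List (Duel K) → Fin K → Prop} {O : Finset (Fin K × Fin K)} {k : ℕ}
    (hP : ∀ h a, P h a → countIn O h < k) (m : ℕ) {h : List (Duel K)} (hk : k ≤ countIn O h) :
    stopVal A Δ P m h = 0 := by
  induction m generalizing h with
  | zero => simp [stopVal]
  | succ m ih =>
    have h1 : ∀ a, ¬ P h a := fun a ha => (hP h a ha).not_ge hk
    have h2 : ∀ p b, stopVal A Δ P m (h ++ [(p, b)]) = 0 := fun p b =>
      ih (by rw [countIn_append]; omega)
    simp [stopVal, h1, h2]

lemma cost_eq_zero (A : Algorithm K) (Δ : Matrix (Fin K) (Fin K) ℝ)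
    {O : Finset (Fin K × Fin K)} (c : Fin K × Fin K → ℝ) {k : ℕ} (m : ℕ)
    {h : List (Duel K)} (hk : k ≤ countIn O h + 1) : cost A Δ O c k m h = 0 := by
  induction m generalizing h with
  | zero => simp [cost]
  | succ m ih =>
    have h2 : ∀ p b, cost A Δ O c k m (h ++ [(p, b)]) = 0 := fun p b =>
      ih (by rw [countIn_append]; omega)
    simp [cost, h2, not_lt.2 hk]

/-- Summing the costs over a family of cost functions whose sum is at most `B` on every pair
of `O`: at most `k - 1` duels are charged. -/
lemma sum_cost_le {S : Type*} [Fintype S] (A : Algorithm K) {Δ : Matrix (Fin K) (Fin K) ℝ}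
    (hΔ : ∀ i j, Δ i j ∈ Set.Icc (-1 / 4 : ℝ) (1 / 4)) {O : Finset (Fin K × Fin K)}
    {c : S → Fin K × Fin K → ℝ} {B : ℝ} (hB : 0 ≤ B) (hc : ∀ p ∈ O, ∑ σ, c σ p ≤ B)
    (k m : ℕ) (h : List (Duel K)) :
    ∑ σ, cost A Δ O (c σ) k m h ≤ B * (k - 1 - countIn O h : ℕ) := by
  induction m generalizing h with
  | zero => simp only [cost, Finset.sum_const_zero]; positivity
  | succ m ih =>
    set N : ℝ := B * (k - 1 - countIn O h : ℕ) with hN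
    have hN0 : 0 ≤ N := by positivity
    simp only [cost]
    rw [Finset.sum_comm]
    have hp (p : Fin K × Fin K) : ∑ σ, (A h (Sum.inl p)).toReal *
        ((if p ∈ O ∧ countIn O h + 1 < k then c σ p else 0) +
          ∑ b, outcomeProb (Δ p.1 p.2) b * cost A Δ O (c σ) k m (h ++ [(p, b)])) ≤
        (A h (Sum.inl p)).toReal * N := by
      rw [← Finset.mul_sum]
      refine mul_le_mul_of_nonneg_left ?_ ENNReal.toReal_nonneg
      rw [Finset.sum_add_distrib, Finset.sum_comm]
      simp only [← Finset.mul_sum]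
      have hb (M : ℝ) (hM : ∀ b, ∑ σ, cost A Δ O (c σ) k m (h ++ [(p, b)]) ≤ M) :
          ∑ b, outcomeProb (Δ p.1 p.2) b * ∑ σ, cost A Δ O (c σ) k m (h ++ [(p, b)]) ≤ M := by
        calc _ ≤ ∑ b, outcomeProb (Δ p.1 p.2) b * M := Finset.sum_le_sum fun b _ =>
              mul_le_mul_of_nonneg_left (hM b) (outcomeProb_nonneg (hΔ _ _) b)
          _ = M := by rw [← Finset.sum_mul, sum_outcomeProb, one_mul]
      by_cases hpO : p ∈ O ∧ countIn O h + 1 < k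
      · have h1 := hb (B * ((k - 1 - countIn O h : ℕ) - 1)) fun b => by
          refine (ih _).trans (le_of_eq ?_)
          rw [countIn_append, if_pos hpO.1, ← Nat.sub_sub, Nat.cast_sub (by omega)]
          simp
        simp only [if_pos hpO]
        linarith [hc p hpO.1]
      · simp only [if_neg hpO, Finset.sum_const_zero, zero_add]
        refine hb N fun b => (ih _).trans ?_
        rw [hN, countIn_append]
        gcongr
        exact Nat.le_add_right _ _
    calc _ ≤ ∑ p, (A h (Sum.inl p)).toReal * N := Finset.sum_le_sum fun p _ => hp p
      _ = (∑ p, (A h (Sum.inl p)).toReal) * N := by rw [Finset.sum_mul]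
      _ ≤ 1 * N := by
        refine mul_le_mul_of_nonneg_right ?_ hN0
        have h1 := sum_toReal_decision A h
        rw [Fintype.sum_sum_type] at h1
        have : 0 ≤ ∑ a, (A h (Sum.inr a)).toReal :=
          Finset.sum_nonneg fun _ _ => ENNReal.toReal_nonneg
        linarith
      _ = N := one_mul N

/-- The Kullback–Leibler divergence of a fair coin from a coin with gap `x` is at most `8/3 x²`. -/
lemma log_outcomeProb_le {x : ℝ} (hx : x ∈ Set.Icc (-1 / 4 : ℝ) (1 / 4)) :
    ∑ b, outcomeProb 0 b * -Real.log (2 * outcomeProb x b) ≤ 8 / 3 * x ^ 2 := by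
  have h1 : 0 < 2 * (1 / 2 + x) := by linarith [hx.1]
  have h2 : 0 < 2 * (1 / 2 - x) := by linarith [hx.2]
  have hsq : x ^ 2 ≤ 1 / 16 := by nlinarith [hx.1, hx.2]
  have h3 : 0 < 1 - 4 * x ^ 2 := by linarith
  have h4 := Real.one_sub_inv_le_log_of_pos h3
  have h5 : (1 - 4 * x ^ 2)⁻¹ ≤ 1 + 16 / 3 * x ^ 2 := by
    rw [inv_le_iff_one_le_mul₀ h3]
    nlinarith [sq_nonneg x]
  have h6 : Real.log (2 * (1 / 2 + x)) + Real.log (2 * (1 / 2 - x)) = Real.log (1 - 4 * x ^ 2) := by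
    rw [← Real.log_mul h1.ne' h2.ne']; congr 1; ring
  simp only [outcomeProb, Fintype.sum_bool, if_true, Bool.false_eq_true, if_false]
  linarith

/-- The change of measure along the tree of histories: `Δ₀` and `Δ₁` agree outside `O`, and `Δ₀`
has no gap on `O`. -/
lemma exp_neg_cost_le_affinity (A : Algorithm K) {Δ₀ Δ₁ : Matrix (Fin K) (Fin K) ℝ}
    (h₀ : ∀ i j, Δ₀ i j ∈ Set.Icc (-1 / 4 : ℝ) (1 / 4))
    (h₁ : ∀ i j, Δ₁ i j ∈ Set.Icc (-1 / 4 : ℝ) (1 / 4)) {O : Finset (Fin K × Fin K)}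
    (hO : ∀ p ∈ O, Δ₀ p.1 p.2 = 0) (hO' : ∀ p ∉ O, Δ₁ p.1 p.2 = Δ₀ p.1 p.2)
    {P : List (Duel K) → Fin K → Prop} {k : ℕ} (hP : ∀ h a, P h a → countIn O h < k) (m : ℕ)
    (h : List (Duel K)) :
    Real.exp (-(1 / 2) * cost A Δ₀ O (fun p => 8 / 3 * Δ₁ p.1 p.2 ^ 2) k m h) ≤
      affinity (stopVal A Δ₀ P m h) (stopVal A Δ₁ P m h) := by
  classical
  induction m generalizing h with
  | zero => simp [cost, stopVal, affinity]
  | succ m ih =>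
    set c : Fin K × Fin K → ℝ := fun p => 8 / 3 * Δ₁ p.1 p.2 ^ 2
    rw [stopVal_succ, stopVal_succ]
    have hcost : cost A Δ₀ O c k (m + 1) h = ∑ d, (A h d).toReal * (0 + Sum.elim
        (fun p => (if p ∈ O ∧ countIn O h + 1 < k then c p else 0) +
          ∑ b, outcomeProb (Δ₀ p.1 p.2) b * cost A Δ₀ O c k m (h ++ [(p, b)]))
        (fun _ => 0) d) := by
      rw [cost, Fintype.sum_sum_type]
      simp
    have hval (Δ : Matrix (Fin K) (Fin K) ℝ) (hΔ : ∀ i j, Δ i j ∈ Set.Icc (-1 / 4 : ℝ) (1 / 4))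
        (d : (Fin K × Fin K) ⊕ Fin K) : Sum.elim (fun p : Fin K × Fin K =>
          ∑ b, outcomeProb (Δ p.1 p.2) b * stopVal A Δ P m (h ++ [(p, b)]))
        (fun a => if P h a then 1 else 0) d ∈ Set.Icc (0 : ℝ) 1 := by
      rcases d with p | a
      · exact sum_outcome_mem_Icc (hΔ _ _) fun b => stopVal_mem_Icc A hΔ P _ _
      · simp only [Sum.elim_inr]; split_ifs <;> simp
    rw [hcost]
    -- The decisions have the same law in both environments.
    refine exp_le_affinity_sum (d := fun _ => 0) (fun _ => ENNReal.toReal_nonneg)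
      (fun _ => ENNReal.toReal_nonneg) (sum_toReal_decision A h) (sum_toReal_decision A h)
      (hval Δ₀ h₀) (hval Δ₁ h₁) (fun d => ?_) ?_
    · rw [Real.sqrt_mul_self ENNReal.toReal_nonneg]; simp
    rintro (p | a)
    swap
    · simp only [Sum.elim_inr]
      split_ifs <;> simp [affinity]
    simp only [Sum.elim_inl]
    have hstep := fun d : Bool → ℝ => exp_le_affinity_sum (d := d)
      (w₀ := outcomeProb (Δ₀ p.1 p.2)) (w₁ := outcomeProb (Δ₁ p.1 p.2))
      (u := fun b => stopVal A Δ₀ P m (h ++ [(p, b)]))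
      (v := fun b => stopVal A Δ₁ P m (h ++ [(p, b)]))
      (C := fun b => cost A Δ₀ O c k m (h ++ [(p, b)]))
      (outcomeProb_nonneg (h₀ _ _)) (outcomeProb_nonneg (h₁ _ _))
      (sum_outcomeProb _) (sum_outcomeProb _) (fun b => stopVal_mem_Icc A h₀ P _ _)
      (fun b => stopVal_mem_Icc A h₁ P _ _)
    by_cases hpO : p ∈ O
    · by_cases hk : countIn O h + 1 < k
      · have hpos : ∀ b, 0 < outcomeProb (Δ₁ p.1 p.2) b := by
          have := h₁ p.1 p.2
          intro b
          cases b <;> simp [outcomeProb] <;> linarith [this.1, this.2]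
        have := hstep (fun b => -Real.log (2 * outcomeProb (Δ₁ p.1 p.2) b))
          (fun b => ?_) (fun b => ih _)
        · refine le_trans (Real.exp_le_exp.2 ?_) this
          have hl := log_outcomeProb_le (h₁ p.1 p.2)
          rw [← hO p hpO] at hl
          simp only [mul_add, Finset.sum_add_distrib, if_pos (And.intro hpO hk), c]
          linarith
        · have h2 : 0 < 2 * outcomeProb (Δ₁ p.1 p.2) b := by linarith [hpos b]
          have h3 : outcomeProb (Δ₀ p.1 p.2) b = 1 / 2 := by
            rw [hO p hpO]; cases b <;> simp [outcomeProb]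
          have h4 : 1 / 2 * outcomeProb (Δ₁ p.1 p.2) b =
              (1 / 2) ^ 2 * (2 * outcomeProb (Δ₁ p.1 p.2) b) := by ring
          rw [h3, h4, Real.sqrt_mul (by norm_num), Real.sqrt_sq (by norm_num),
            show -(1 / 2) * -Real.log (2 * outcomeProb (Δ₁ p.1 p.2) b) =
              Real.log (2 * outcomeProb (Δ₁ p.1 p.2) b) * (1 / 2) by ring,
            ← Real.rpow_def_of_pos h2, ← Real.sqrt_eq_rpow]
      · -- After this duel, the event is impossible in both environments.
        have hc : ∀ b, k ≤ countIn O (h ++ [(p, b)]) := fun b => by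
          rw [countIn_append, if_pos hpO]; omega
        simp [stopVal_eq_zero A _ hP m (hc _), cost_eq_zero A Δ₀ c m ((hc _).trans (Nat.le_succ _)),
          hk, affinity]
    · have := hstep (fun _ => 0) (fun b => ?_) (fun b => ih _)
      · simpa [hpO] using this
      · rw [hO' p hpO, Real.sqrt_mul_self (outcomeProb_nonneg (h₀ _ _) b)]; simp

/-! ### Means over finite families -/

/-- The mean of a real function over a finite type. -/
def mean {S : Type*} [Fintype S] (f : S → ℝ) : ℝ := ∑ σ, (Fintype.card S : ℝ)⁻¹ * f σ

section mean

variable {S : Type*} [Fintype S]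

lemma sum_inv_card [Nonempty S] : ∑ _σ : S, (Fintype.card S : ℝ)⁻¹ = 1 := by
  rw [Finset.sum_const, Finset.card_univ, nsmul_eq_mul,
    mul_inv_cancel₀ (by exact_mod_cast Fintype.card_ne_zero)]

lemma mean_const [Nonempty S] (c : ℝ) : mean (fun _ : S => c) = c := by
  rw [mean, ← Finset.sum_mul, sum_inv_card, one_mul]

lemma mean_add (f g : S → ℝ) : mean (fun σ => f σ + g σ) = mean f + mean g := by
  simp only [mean, mul_add, Finset.sum_add_distrib]

lemma mean_sum_mul {ι : Type*} (s : Finset ι) (c : ι → ℝ) (f : ι → S → ℝ) :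
    mean (fun σ => ∑ i ∈ s, c i * f i σ) = ∑ i ∈ s, c i * mean (f i) := by
  simp only [mean, Finset.mul_sum]
  rw [Finset.sum_comm]
  exact Finset.sum_congr rfl fun i _ => Finset.sum_congr rfl fun σ _ => by ring

lemma mean_comm {T : Type*} [Fintype T] (f : S → T → ℝ) :
    (mean fun σ => mean (f σ)) = mean fun τ => mean fun σ => f σ τ := by
  simp only [mean, Finset.mul_sum]
  rw [Finset.sum_comm]
  exact Finset.sum_congr rfl fun σ _ => Finset.sum_congr rfl fun τ _ => by ring

lemma mean_mono {f g : S → ℝ} (h : ∀ σ, f σ ≤ g σ) : mean f ≤ mean g :=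
  Finset.sum_le_sum fun σ _ => mul_le_mul_of_nonneg_left (h σ) (by positivity)

lemma mean_lt [Nonempty S] {f : S → ℝ} {c : ℝ} (h : ∀ σ, f σ < c) : mean f < c := by
  rw [← mean_const (S := S) c]
  exact Finset.sum_lt_sum_of_nonempty Finset.univ_nonempty fun σ _ =>
    mul_lt_mul_of_pos_left (h σ) (inv_pos.2 (by exact_mod_cast Fintype.card_pos))

lemma mean_mem_Icc [Nonempty S] {f : S → ℝ} (h : ∀ σ, f σ ∈ Set.Icc (0 : ℝ) 1) :
    mean f ∈ Set.Icc (0 : ℝ) 1 :=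
  sum_mul_mem_Icc (fun _ => by positivity) sum_inv_card h

end mean

/-! ### Change of measure averaged over a family of environments -/

/-- The averaged form of the change of measure: over a family of environments `Δ₁ σ` whose squared
gaps average to at most `V` on each pair of `O`, the mean probability of the event remains close
to its probability under `Δ₀`. -/
lemma exp_le_affinity_average {S : Type*} [Fintype S] [Nonempty S] (A : Algorithm K)
    {Δ₀ : Matrix (Fin K) (Fin K) ℝ} {Δ₁ : S → Matrix (Fin K) (Fin K) ℝ}
    (h₀ : ∀ i j, Δ₀ i j ∈ Set.Icc (-1 / 4 : ℝ) (1 / 4))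
    (h₁ : ∀ σ i j, Δ₁ σ i j ∈ Set.Icc (-1 / 4 : ℝ) (1 / 4)) {O : Finset (Fin K × Fin K)}
    (hO : ∀ p ∈ O, Δ₀ p.1 p.2 = 0) (hO' : ∀ σ, ∀ p ∉ O, Δ₁ σ p.1 p.2 = Δ₀ p.1 p.2)
    {P : List (Duel K) → Fin K → Prop} {k : ℕ} (hP : ∀ h a, P h a → countIn O h < k)
    {V : ℝ} (hV0 : 0 ≤ V)
    (hV : ∀ p ∈ O, ∑ σ, Δ₁ σ p.1 p.2 ^ 2 ≤ Fintype.card S * V) (m : ℕ) :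
    Real.exp (-(4 / 3 * ((k - 1 : ℕ) * V))) ≤
      affinity (stopVal A Δ₀ P m [])
        (mean fun σ => stopVal A (Δ₁ σ) P m []) := by
  set n : ℝ := (Fintype.card S : ℝ) with hn
  have hn0 : 0 < n := by rw [hn]; exact_mod_cast Fintype.card_pos
  have hw1 : ∑ _σ : S, n⁻¹ = 1 := sum_inv_card
  have hstep := exp_le_affinity_sum (ι := S) (w₀ := fun _ => n⁻¹) (w₁ := fun _ => n⁻¹)
    (u := fun _ => stopVal A Δ₀ P m []) (v := fun σ => stopVal A (Δ₁ σ) P m [])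
    (d := fun _ => 0) (C := fun σ => cost A Δ₀ O (fun p => 8 / 3 * Δ₁ σ p.1 p.2 ^ 2) k m [])
    (fun _ => by positivity) (fun _ => by positivity) hw1 hw1
    (fun _ => stopVal_mem_Icc A h₀ P m _) (fun σ => stopVal_mem_Icc A (h₁ σ) P m _)
    (fun _ => by rw [Real.sqrt_mul_self (by positivity)]; simp)
    (fun σ => exp_neg_cost_le_affinity A h₀ (h₁ σ) hO (hO' σ) hP m [])
  rw [← Finset.sum_mul, hw1, one_mul] at hstep
  refine le_trans (Real.exp_le_exp.2 ?_) hstep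
  have hc := sum_cost_le A h₀ (O := O) (c := fun σ p => 8 / 3 * Δ₁ σ p.1 p.2 ^ 2)
    (B := 8 / 3 * (n * V)) (by positivity) (fun p hp => by
      rw [← Finset.mul_sum]; linarith [hV p hp]) k m []
  have h2 : n⁻¹ * ∑ σ, cost A Δ₀ O (fun p => 8 / 3 * Δ₁ σ p.1 p.2 ^ 2) k m [] ≤
      n⁻¹ * (8 / 3 * (n * V) * (k - 1 : ℕ)) := by
    refine mul_le_mul_of_nonneg_left ?_ (by positivity)
    simpa [countIn] using hc
  have h3 : n⁻¹ * (8 / 3 * (n * V) * (k - 1 : ℕ)) = 8 / 3 * ((k - 1 : ℕ) * V) := by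
    field_simp
  simp only [zero_add]
  rw [← Finset.mul_sum]
  linarith


/-! ### Permuting the negative entries of the rows -/

section permuteNeg

variable {Δ : Matrix (Fin K) (Fin K) ℝ} {π : Fin K → Equiv.Perm (Fin K)}

lemma apply_eq_neg (hΔ : Δ ∈ Dcw K) (i j : Fin K) : Δ i j = -Δ j i := by
  conv_lhs => rw [hΔ.2.1]
  rfl

lemma sign_permuteNeg (hΔ : Δ ∈ Dcw K) (hπ : ∀ i j, Δ i j < 0 ↔ Δ i (π i j) < 0) (i j : Fin K) :
    SignType.sign (permuteNeg Δ π i j) = SignType.sign (Δ i j) := by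
  unfold permuteNeg
  split_ifs with h1 h2
  · rw [sign_neg h1, sign_neg ((hπ i j).1 h1)]
  · have h3 : Δ j i < 0 := by linarith [apply_eq_neg hΔ i j]
    have h4 := (hπ j i).1 h3
    rw [sign_pos h2, sign_pos (by linarith)]
  · rfl

lemma permuteNeg_neg_iff (hΔ : Δ ∈ Dcw K) (hπ : ∀ i j, Δ i j < 0 ↔ Δ i (π i j) < 0)
    (i j : Fin K) : permuteNeg Δ π i j < 0 ↔ Δ i j < 0 := by
  rw [← sign_eq_neg_one_iff, sign_permuteNeg hΔ hπ, sign_eq_neg_one_iff]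

lemma permuteNeg_pos_iff (hΔ : Δ ∈ Dcw K) (hπ : ∀ i j, Δ i j < 0 ↔ Δ i (π i j) < 0)
    (i j : Fin K) : 0 < permuteNeg Δ π i j ↔ 0 < Δ i j := by
  rw [← sign_eq_one_iff, sign_permuteNeg hΔ hπ, sign_eq_one_iff]

lemma permuteNeg_mem_Icc (hΔ : Δ ∈ Dcw K) (i j : Fin K) :
    permuteNeg Δ π i j ∈ Set.Icc (-1 / 4 : ℝ) (1 / 4) := by
  unfold permuteNeg
  split_ifs
  · exact hΔ.1 _ _
  · have := hΔ.1 j (π j i)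
    constructor <;> linarith [this.1, this.2]
  · exact hΔ.1 _ _

lemma permuteNeg_eq_neg_transpose (hΔ : Δ ∈ Dcw K) :
    permuteNeg Δ π = -(permuteNeg Δ π).transpose := by
  ext i j
  have h := apply_eq_neg hΔ i j
  simp only [permuteNeg, Matrix.neg_apply, Matrix.transpose_apply]
  rcases lt_trichotomy (Δ i j) 0 with h1 | h1 | h1
  · have h2 : 0 < Δ j i := by linarith
    simp [h1, h2, h2.not_gt]
  · have h2 : Δ j i = 0 := by linarith
    simp [h1, h2]
  · have h2 : Δ j i < 0 := by linarith
    simp [h1, h2, h1.not_gt]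

lemma isCondorcetWinner_permuteNeg (hΔ : Δ ∈ Dcw K)
    (hπ : ∀ i j, Δ i j < 0 ↔ Δ i (π i j) < 0) {istar : Fin K} (h : IsCondorcetWinner Δ istar) :
    IsCondorcetWinner (permuteNeg Δ π) istar :=
  fun j hj => (permuteNeg_pos_iff hΔ hπ _ _).2 (h j hj)

lemma permuteNeg_mem_Dcw (hΔ : Δ ∈ Dcw K) (hπ : ∀ i j, Δ i j < 0 ↔ Δ i (π i j) < 0) :
    permuteNeg Δ π ∈ Dcw K :=
  ⟨permuteNeg_mem_Icc hΔ, permuteNeg_eq_neg_transpose hΔ,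
    hΔ.2.2.imp fun _ h => isCondorcetWinner_permuteNeg hΔ hπ h⟩

lemma negEntries_permuteNeg (hΔ : Δ ∈ Dcw K) (hπ : ∀ i j, Δ i j < 0 ↔ Δ i (π i j) < 0)
    (i : Fin K) : negEntries (permuteNeg Δ π) i = negEntries Δ i := by
  unfold negEntries
  simp only [permuteNeg_neg_iff hΔ hπ]
  have h1 : (Finset.univ.filter fun j => Δ i j < 0).val.map (permuteNeg Δ π i) =
      (Finset.univ.filter fun j => Δ i j < 0).val.map (Δ i ∘ π i) := by
    refine Multiset.map_congr rfl fun j hj => ?_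
    have : Δ i j < 0 := by simpa using hj
    simp [permuteNeg, this]
  have h2 : (Finset.univ.filter fun j => Δ i j < 0).map (π i).toEmbedding =
      Finset.univ.filter fun j => Δ i j < 0 := by
    ext j
    simp only [Finset.mem_map_equiv, Finset.mem_filter, Finset.mem_univ, true_and]
    rw [hπ]
    simp
  rw [h1, ← Multiset.map_map]
  conv_rhs => rw [← h2]
  rfl

/-- The local class only depends on the multisets of negative entries. -/
lemma permuteNeg_mem_localClass (hΔ : Δ ∈ Dcw K) (hπ : ∀ i j, Δ i j < 0 ↔ Δ i (π i j) < 0)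
    {istar : Fin K} (h : IsCondorcetWinner Δ istar) (c δ : ℝ) :
    permuteNeg Δ π ∈ localClass c δ Δ istar := by
  have ho : ∀ i s, ordEntry (permuteNeg Δ π) i s = ordEntry Δ i s := fun i s => by
    rw [ordEntry, ordEntry, negEntries_permuteNeg hΔ hπ]
  have hn : ∀ i, numNeg (permuteNeg Δ π) i = numNeg Δ i := fun i => by
    simp only [numNeg, permuteNeg_neg_iff hΔ hπ]
  refine ⟨permuteNeg_mem_Dcw hΔ hπ, isCondorcetWinner_permuteNeg hΔ hπ h, fun s => ?_,
    fun s _ i _ => ho i _⟩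
  simp only [IsEffectiveSparsity, IsAdmissible, Hcertify, Hexplore, ho, hn]

end permuteNeg

/-- The pairs made of `i` and of an arm that beats `i`, in both orders. -/
def losingPairs (Δ : Matrix (Fin K) (Fin K) ℝ) (i : Fin K) : Finset (Fin K × Fin K) :=
  Finset.univ.filter fun p => p.1 = i ∧ Δ i p.2 < 0 ∨ p.2 = i ∧ Δ i p.1 < 0

/-- A pair of arms has only one loser. -/
lemma eq_of_mem_losingPairs {Δ : Matrix (Fin K) (Fin K) ℝ} (hΔ : Δ ∈ Dcw K) {i i' : Fin K}
    {p : Fin K × Fin K} (h : p ∈ losingPairs Δ i) (h' : p ∈ losingPairs Δ i') : i = i' := by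
  simp only [losingPairs, Finset.mem_filter, Finset.mem_univ, true_and] at h h'
  have := apply_eq_neg hΔ p.1 p.2
  rcases h with ⟨rfl, h⟩ | ⟨rfl, h⟩ <;> rcases h' with ⟨h1, h'⟩ | ⟨h1, h'⟩ <;>
    first | exact h1 | (rw [← h1] at h'; linarith)

lemma sum_countIn_losingPairs_le {Δ : Matrix (Fin K) (Fin K) ℝ} (hΔ : Δ ∈ Dcw K)
    (s : Finset (Fin K)) (h : List (Duel K)) :
    ∑ i ∈ s, countIn (losingPairs Δ i) h ≤ h.length := by
  induction h with
  | nil => simp [countIn]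
  | cons d h ih =>
    have h1 : ∀ i, countIn (losingPairs Δ i) (d :: h) =
        countIn (losingPairs Δ i) h + if d.1 ∈ losingPairs Δ i then 1 else 0 := fun i => by
      simp [countIn, List.countP_cons]
    simp only [h1, Finset.sum_add_distrib, List.length_cons]
    refine add_le_add ih ?_
    rw [← Finset.card_filter, Finset.card_le_one]
    intro i hi i' hi'
    exact eq_of_mem_losingPairs hΔ (Finset.mem_filter.1 hi).2 (Finset.mem_filter.1 hi').2

/-- The matrix obtained from `Δ` by raising all the negative entries of row `i` to `ε`, the
entries of column `i` being adapted. For `ε > 0`, arm `i` becomes a Condorcet winner. -/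
def raiseRow (Δ : Matrix (Fin K) (Fin K) ℝ) (i : Fin K) (ε : ℝ) : Matrix (Fin K) (Fin K) ℝ :=
  fun a b => if a = i ∧ Δ i b < 0 then ε else if b = i ∧ Δ i a < 0 then -ε else Δ a b

lemma diag_eq_zero {Δ : Matrix (Fin K) (Fin K) ℝ} (hΔ : Δ ∈ Dcw K) (i : Fin K) : Δ i i = 0 := by
  linarith [apply_eq_neg hΔ i i]

lemma raiseRow_mem_Icc {Δ : Matrix (Fin K) (Fin K) ℝ} (hΔ : Δ ∈ Dcw K) (i : Fin K) {ε : ℝ}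
    (h0 : 0 ≤ ε) (h1 : ε ≤ 1 / 4) (a b : Fin K) :
    raiseRow Δ i ε a b ∈ Set.Icc (-1 / 4 : ℝ) (1 / 4) := by
  unfold raiseRow
  split_ifs
  · constructor <;> linarith
  · constructor <;> linarith
  · exact hΔ.1 a b

lemma isCondorcetWinner_raiseRow {Δ : Matrix (Fin K) (Fin K) ℝ} (hties : ∀ i j, i ≠ j → Δ i j ≠ 0)
    (i : Fin K) {ε : ℝ} (h0 : 0 < ε) : IsCondorcetWinner (raiseRow Δ i ε) i := by
  intro j hj
  unfold raiseRow
  split_ifs with h1 h2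
  · exact h0
  · exact absurd h2.1 hj
  · have h3 : ¬ Δ i j < 0 := fun h => h1 ⟨rfl, h⟩
    exact lt_of_le_of_ne (not_lt.1 h3) (hties i j hj.symm).symm

lemma raiseRow_mem_Dcw {Δ : Matrix (Fin K) (Fin K) ℝ} (hΔ : Δ ∈ Dcw K)
    (hties : ∀ i j, i ≠ j → Δ i j ≠ 0) (i : Fin K) {ε : ℝ} (h0 : 0 < ε) (h1 : ε ≤ 1 / 4) :
    raiseRow Δ i ε ∈ Dcw K := by
  refine ⟨raiseRow_mem_Icc hΔ i h0.le h1, ?_, i, isCondorcetWinner_raiseRow hties i h0⟩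
  ext a b
  have hd := diag_eq_zero hΔ i
  have hab := apply_eq_neg hΔ a b
  simp only [raiseRow, Matrix.neg_apply, Matrix.transpose_apply]
  by_cases ha : a = i <;> by_cases hb : b = i
  · subst ha; subst hb; simp [hd]
  · subst ha
    by_cases h : Δ a b < 0
    · simp [hb, h]
    · simpa [hb, h] using hab
  · subst hb
    by_cases h : Δ b a < 0
    · simp [ha, h]
    · simpa [ha, h] using hab
  · simpa [ha, hb] using hab

lemma continuous_raiseRow (Δ : Matrix (Fin K) (Fin K) ℝ) (i : Fin K) :
    Continuous (raiseRow Δ i) := by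
  refine continuous_matrix fun a b => ?_
  unfold raiseRow
  split_ifs <;> fun_prop

/-! ### Averages over permutations -/

lemma sum_perm_apply {J : Type*} [Fintype J] [DecidableEq J] (f : J → ℝ) (x : J) :
    Fintype.card J * ∑ σ : Equiv.Perm J, f (σ x) =
      Fintype.card (Equiv.Perm J) * ∑ y, f y := by
  have h1 : ∀ y, ∑ σ : Equiv.Perm J, f (σ y) = ∑ σ : Equiv.Perm J, f (σ x) := fun y => by
    rw [← Equiv.sum_comp (Equiv.mulRight (Equiv.swap x y))]
    simp
  calc _ = ∑ y : J, ∑ σ : Equiv.Perm J, f (σ y) := by simp [h1]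
    _ = ∑ σ : Equiv.Perm J, ∑ y, f y := by
      rw [Finset.sum_comm]
      exact Finset.sum_congr rfl fun σ _ => Equiv.sum_comp σ f
    _ = _ := by simp

/-- A choice, for every row, of a permutation of the positions of its negative entries. -/
abbrev RowPerms (Δ : Matrix (Fin K) (Fin K) ℝ) : Type :=
  ∀ i : Fin K, Equiv.Perm {j // Δ i j < 0}

/-- The row-wise permutations, extended by the identity off the negative entries. -/
def RowPerms.extend {Δ : Matrix (Fin K) (Fin K) ℝ} (τ : RowPerms Δ) (i : Fin K) :
    Equiv.Perm (Fin K) :=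
  Equiv.Perm.ofSubtype (τ i)

lemma RowPerms.extend_neg_iff {Δ : Matrix (Fin K) (Fin K) ℝ} (τ : RowPerms Δ) (i j : Fin K) :
    Δ i j < 0 ↔ Δ i (τ.extend i j) < 0 :=
  (Equiv.Perm.ofSubtype_apply_mem_iff_mem (τ i) j).symm

instance (Δ : Matrix (Fin K) (Fin K) ℝ) : Fintype (RowPerms Δ) := Fintype.ofFinite _

/-- The row-wise permutations `τ`, preceded in row `i` by the permutation `σ`. -/
def RowPerms.shift {Δ : Matrix (Fin K) (Fin K) ℝ} (τ : RowPerms Δ) (i : Fin K)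
    (σ : Equiv.Perm {j // Δ i j < 0}) : RowPerms Δ :=
  τ * Pi.mulSingle i σ

/-- A uniformly random choice of the permutations is unchanged by a random shift of row `i`. -/
lemma RowPerms.mean_mean_shift {Δ : Matrix (Fin K) (Fin K) ℝ} (i : Fin K) (F : RowPerms Δ → ℝ) :
    (mean fun τ : RowPerms Δ => mean fun σ : Equiv.Perm {j // Δ i j < 0} => F (τ.shift i σ)) =
      mean F := by
  have h (σ : Equiv.Perm {j // Δ i j < 0}) :
      (mean fun τ : RowPerms Δ => F (τ.shift i σ)) = mean F :=
    Equiv.sum_comp (Equiv.mulRight (Pi.mulSingle i σ : RowPerms Δ))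
      fun τ => (Fintype.card (RowPerms Δ) : ℝ)⁻¹ * F τ
  exact (mean_comm _).trans ((congrArg mean (funext h)).trans (mean_const _))

/-- The environment obtained from `Δ` by the row-wise permutations `τ`. -/
def RowPerms.env {Δ : Matrix (Fin K) (Fin K) ℝ} (τ : RowPerms Δ) : Matrix (Fin K) (Fin K) ℝ :=
  permuteNeg Δ τ.extend

lemma numNeg_eq_card (Δ : Matrix (Fin K) (Fin K) ℝ) (i : Fin K) :
    numNeg Δ i = Fintype.card {j // Δ i j < 0} := by
  rw [numNeg, Fintype.card_subtype]

lemma sqNormNeg_eq_sum (Δ : Matrix (Fin K) (Fin K) ℝ) (i : Fin K) :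
    sqNormNeg Δ i = ∑ j : {j // Δ i j < 0}, Δ i j ^ 2 := by
  rw [sqNormNeg, ← Finset.sum_subtype (Finset.univ.filter fun j => Δ i j < 0) (by simp)
    (fun j => Δ i j ^ 2), Finset.sum_filter]
  refine Finset.sum_congr rfl fun j _ => ?_
  split_ifs with h
  · rw [min_eq_left h.le]
  · rw [min_eq_right (not_lt.1 h)]; norm_num

lemma env_neg_iff {Δ : Matrix (Fin K) (Fin K) ℝ} (hΔ : Δ ∈ Dcw K) (τ : RowPerms Δ)
    (i j : Fin K) : τ.env i j < 0 ↔ Δ i j < 0 :=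
  permuteNeg_neg_iff hΔ τ.extend_neg_iff i j

lemma extend_shift_of_ne {Δ : Matrix (Fin K) (Fin K) ℝ} (τ : RowPerms Δ) {i i' : Fin K}
    (h : i' ≠ i) (σ : Equiv.Perm {j // Δ i j < 0}) :
    (τ.shift i σ).extend i' = τ.extend i' := by
  rw [RowPerms.extend, RowPerms.shift, Pi.mul_apply, Pi.mulSingle_eq_of_ne h, mul_one,
    RowPerms.extend]

/-- Off the pairs that `i` loses, permuting row `i` does not change the environment. -/
lemma env_shift_of_notMem {Δ : Matrix (Fin K) (Fin K) ℝ} (hΔ : Δ ∈ Dcw K)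
    (τ : RowPerms Δ) (i : Fin K) (σ : Equiv.Perm {j // Δ i j < 0}) {p : Fin K × Fin K}
    (hp : p ∉ losingPairs Δ i) :
    (τ.shift i σ).env p.1 p.2 = raiseRow τ.env i 0 p.1 p.2 := by
  obtain ⟨a, b⟩ := p
  simp only [losingPairs, Finset.mem_filter, Finset.mem_univ, true_and, not_or] at hp
  obtain ⟨h1, h2⟩ := hp
  simp only [raiseRow, env_neg_iff hΔ, if_neg h1, if_neg h2]
  unfold RowPerms.env permuteNeg
  have hab := apply_eq_neg hΔ a b
  by_cases ha : Δ a b < 0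
  · have : a ≠ i := fun h => h1 ⟨h, h ▸ ha⟩
    simp only [if_pos ha, extend_shift_of_ne τ this]
  · by_cases ha' : 0 < Δ a b
    · have : b ≠ i := fun h => h2 ⟨h, by rw [← h]; linarith⟩
      simp only [if_neg ha, if_pos ha', extend_shift_of_ne τ this]
    · simp only [if_neg ha, if_neg ha']

lemma raiseRow_zero_of_mem {Δ : Matrix (Fin K) (Fin K) ℝ} (hΔ : Δ ∈ Dcw K) (τ : RowPerms Δ)
    (i : Fin K) {p : Fin K × Fin K} (hp : p ∈ losingPairs Δ i) :
    raiseRow τ.env i 0 p.1 p.2 = 0 := by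
  simp only [losingPairs, Finset.mem_filter, Finset.mem_univ, true_and] at hp
  simp only [raiseRow, env_neg_iff hΔ]
  rcases hp with h | h
  · rw [if_pos h]
  · rw [if_pos h, neg_zero, ite_self]

/-- When row `i` is permuted uniformly at random, the mean square gap of each pair that `i` loses
is `‖Δ_i^-‖² / K_{i;<0}`. -/
lemma sum_env_sq {Δ : Matrix (Fin K) (Fin K) ℝ} (hΔ : Δ ∈ Dcw K) (τ : RowPerms Δ) (i : Fin K)
    {p : Fin K × Fin K} (hp : p ∈ losingPairs Δ i) :
    ∑ σ : Equiv.Perm {j // Δ i j < 0}, (τ.shift i σ).env p.1 p.2 ^ 2 =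
      Fintype.card (Equiv.Perm {j // Δ i j < 0}) * (sqNormNeg Δ i / numNeg Δ i) := by
  have key (j : {j // Δ i j < 0}) : ∑ σ : Equiv.Perm {j // Δ i j < 0},
      Δ i ((τ.shift i σ).extend i j) ^ 2 =
      Fintype.card (Equiv.Perm {j // Δ i j < 0}) * (sqNormNeg Δ i / numNeg Δ i) := by
    have h1 (σ : Equiv.Perm {j // Δ i j < 0}) :
        (τ.shift i σ).extend i j = ((τ i * σ) j : Fin K) := by
      rw [RowPerms.extend, RowPerms.shift, Pi.mul_apply, Pi.mulSingle_eq_same,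
        Equiv.Perm.ofSubtype_apply_coe]
    simp only [h1]
    have hcard : 0 < Fintype.card {j // Δ i j < 0} := Fintype.card_pos_iff.2 ⟨j⟩
    have h2 := sum_perm_apply (fun y : {j // Δ i j < 0} => Δ i y ^ 2) j
    rw [← Equiv.sum_comp (Equiv.mulLeft (τ i)), ← sqNormNeg_eq_sum] at h2
    rw [numNeg_eq_card]
    have hc : (Fintype.card {j // Δ i j < 0} : ℝ) ≠ 0 := by exact_mod_cast hcard.ne'
    rw [← mul_div_assoc, eq_div_iff hc, ← h2, mul_comm]
    rfl
  obtain ⟨a, b⟩ := p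
  simp only [losingPairs, Finset.mem_filter, Finset.mem_univ, true_and] at hp
  rcases hp with ⟨rfl, h⟩ | ⟨rfl, h⟩
  · rw [← key ⟨b, h⟩]
    exact Finset.sum_congr rfl fun σ _ => by simp only [RowPerms.env, permuteNeg, if_pos h]
  · have h' : 0 < Δ a b := by linarith [apply_eq_neg hΔ a b]
    rw [← key ⟨a, h⟩]
    exact Finset.sum_congr rfl fun σ _ => by
      simp only [RowPerms.env, permuteNeg, if_neg h'.not_gt, if_pos h', neg_sq]


/-! ### Consequences of correctness -/

/-- The history contains fewer than `k` duels informative for `i`, and the recommendation differs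
from `i`. -/
def EarlyReject (Δ : Matrix (Fin K) (Fin K) ℝ) (i : Fin K) (k : ℕ) (h : List (Duel K))
    (a : Fin K) : Prop :=
  a ≠ i ∧ countIn (losingPairs Δ i) h < k

/-- The event that the algorithm stops within fewer than `m` duels, at least `k` of which are among
the pairs that `i` loses. -/
def exploreEvent (Δ : Matrix (Fin K) (Fin K) ℝ) (i : Fin K) (k m : ℕ) : Set (ℕ → Round K) :=
  stopEvent m fun h _ => k ≤ countIn (losingPairs Δ i) h

/-- The probability that the budget is at least `b`. -/
def budgetProb (A : Algorithm K) (Δ : Matrix (Fin K) (Fin K) ℝ) (b : ℝ) : ℝ :=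
  (law A Δ).real {ω | ENNReal.ofReal b ≤ (budget ω : ENNReal)}

variable {A : Algorithm K} {δ : ℝ} {Δ : Matrix (Fin K) (Fin K) ℝ}

/-- In the environment where the losses of `i` are replaced by zero gaps, a `δ`-correct algorithm
rejects `i` with probability at most `δ`: this is a limit of environments won by `i`. -/
lemma stopVal_raiseRow_le (hA : IsDeltaCorrect A δ) (hΔ : Δ ∈ Dcw K)
    (hties : ∀ i j, i ≠ j → Δ i j ≠ 0) (i : Fin K) {P : List (Duel K) → Fin K → Prop}
    (hP : ∀ h a, P h a → a ≠ i) (m : ℕ) : stopVal A (raiseRow Δ i 0) P m [] ≤ δ := by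
  have hcont : Continuous fun ε => stopVal A (raiseRow Δ i ε) P m [] :=
    (continuous_stopVal A P m []).comp (continuous_raiseRow Δ i)
  have hlim : Filter.Tendsto (fun ε => stopVal A (raiseRow Δ i ε) P m [])
      (nhdsWithin 0 (Set.Ioi 0)) (nhds (stopVal A (raiseRow Δ i 0) P m [])) :=
    (hcont.tendsto 0).mono_left nhdsWithin_le_nhds
  refine le_of_tendsto hlim ?_
  filter_upwards [Ioc_mem_nhdsGT (show (0 : ℝ) < 1 / 4 by norm_num)] with ε hε
  rw [← law_stopEvent A (raiseRow_mem_Icc hΔ i hε.1.le hε.2)]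
  refine le_trans (measureReal_mono ?_) (hA _ (raiseRow_mem_Dcw hΔ hties i hε.1 hε.2) i
    (isCondorcetWinner_raiseRow hties i hε.1))
  rintro ω ⟨t, -, -, a, hl, ha, hPa⟩
  exact ⟨a, recommendation_eq hl ha, hP _ _ hPa⟩

/-- In an environment where `i` is not the Condorcet winner, either `i` is rejected early, or the
budget is large, or `i` is wrongly recommended, or there are many duels informative for `i`. -/
lemma one_le_stopVal_add {Δ' : Matrix (Fin K) (Fin K) ℝ} (hA : IsDeltaCorrect A δ)
    (hΔ' : Δ' ∈ Dcw K) {istar i : Fin K} (histar : IsCondorcetWinner Δ' istar) (hi : i ≠ istar)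
    (k : ℕ) (b : ℝ) :
    1 ≤ stopVal A Δ' (EarlyReject Δ i k) ⌈b⌉₊ [] + budgetProb A Δ' b + δ +
      (law A Δ').real (exploreEvent Δ i k ⌈b⌉₊) := by
  rw [← law_stopEvent A hΔ'.1]
  have hδ := hA Δ' hΔ' istar histar
  have hcover : (Set.univ : Set (ℕ → Round K)) ⊆
      ((stopEvent ⌈b⌉₊ (EarlyReject Δ i k) ∪ {ω | ENNReal.ofReal b ≤ (budget ω : ENNReal)}) ∪
        {ω | ∃ a, recommendation ω = some a ∧ a ≠ istar}) ∪ exploreEvent Δ i k ⌈b⌉₊ := by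
    intro ω _
    by_cases hb : ENNReal.ofReal b ≤ (budget ω : ENNReal)
    · exact Or.inl (Or.inl (Or.inr hb))
    obtain ⟨t, ht, a, hl, ha⟩ := exists_first_stop hb
    by_cases hai : a = i
    · exact Or.inl (Or.inr ⟨a, recommendation_eq hl ha, hai ▸ hi⟩)
    rcases lt_or_ge (countIn (losingPairs Δ i) (hist ω t)) k with hk | hk
    · exact Or.inl (Or.inl (Or.inl ⟨t, zero_le, by simpa using ht, a, hl, ha, hai, hk⟩))
    · exact Or.inr ⟨t, zero_le, by simpa using ht, a, hl, ha, hk⟩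
  have h1 := measureReal_mono (μ := law A Δ') hcover
  rw [probReal_univ] at h1
  refine h1.trans ((measureReal_union_le _ _).trans (add_le_add ?_ le_rfl))
  refine (measureReal_union_le _ _).trans (add_le_add ?_ hδ)
  exact measureReal_union_le _ _

/-- Averaging over the permutations of row `i` makes the losses of `i` hard to detect: `r₀` and `q`
are the probabilities that `i` is rejected after fewer than `k` informative duels, when the
losses of `i` are erased and when they are permuted at random. -/
lemma exists_exp_le_affinity (hA : IsDeltaCorrect A δ) (hΔ : Δ ∈ Dcw K)
    (hties : ∀ i j, i ≠ j → Δ i j ≠ 0) {istar i : Fin K} (histar : IsCondorcetWinner Δ istar)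
    (hi : i ≠ istar) (τ : RowPerms Δ) (k : ℕ) (b : ℝ) :
    ∃ r₀ ∈ Set.Icc (0 : ℝ) δ, ∃ q ∈ Set.Icc (0 : ℝ) 1,
      Real.exp (-(4 / 3 * ((k - 1 : ℕ) * (sqNormNeg Δ i / numNeg Δ i)))) ≤ affinity r₀ q ∧
      1 - q ≤ δ +
        (mean fun σ : Equiv.Perm {j // Δ i j < 0} => budgetProb A (τ.shift i σ).env b) +
        (mean fun σ : Equiv.Perm {j // Δ i j < 0} =>
          (law A (τ.shift i σ).env).real (exploreEvent Δ i k ⌈b⌉₊)) := by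
  have henv (τ : RowPerms Δ) : τ.env ∈ Dcw K := permuteNeg_mem_Dcw hΔ τ.extend_neg_iff
  have htiesE : ∀ a b, a ≠ b → τ.env a b ≠ 0 := fun a b hab => by
    rw [← sign_ne_zero, RowPerms.env, sign_permuteNeg hΔ τ.extend_neg_iff, sign_ne_zero]
    exact hties a b hab
  have h₀ := raiseRow_mem_Icc (henv τ) i (le_refl (0 : ℝ)) (by norm_num)
  have hV0 : 0 ≤ sqNormNeg Δ i / numNeg Δ i := by
    rw [sqNormNeg_eq_sum]; positivity
  refine ⟨stopVal A (raiseRow τ.env i 0) (EarlyReject Δ i k) ⌈b⌉₊ [],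
    ⟨(stopVal_mem_Icc A h₀ _ _ _).1,
      stopVal_raiseRow_le hA (henv τ) htiesE i (fun _ _ h => h.1) _⟩, _,
    mean_mem_Icc fun σ => stopVal_mem_Icc A (henv (τ.shift i σ)).1
      (EarlyReject Δ i k) ⌈b⌉₊ [],
    ?_, ?_⟩
  · exact exp_le_affinity_average A h₀ (fun σ => (henv _).1)
      (fun p hp => raiseRow_zero_of_mem hΔ τ i hp)
      (fun σ p hp => env_shift_of_notMem hΔ τ i σ hp) (fun h a hP => hP.2) hV0
      (fun p hp => (sum_env_sq hΔ τ i hp).le) _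
  · have h1 (σ : Equiv.Perm {j // Δ i j < 0}) := one_le_stopVal_add (Δ := Δ) hA
      (henv (τ.shift i σ))
      (isCondorcetWinner_permuteNeg hΔ (RowPerms.extend_neg_iff _) histar) hi k b
    have h2 := mean_mono h1
    rw [mean_const, mean_add, mean_add, mean_add, mean_const] at h2
    linarith

/-! ### The two lower bounds -/

lemma numNeg_pos (hΔ : Δ ∈ Dcw K) {istar i : Fin K} (histar : IsCondorcetWinner Δ istar)
    (hi : i ≠ istar) : 0 < numNeg Δ i := by
  refine Finset.card_pos.2 ⟨istar, ?_⟩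
  have := histar i hi
  simp only [Finset.mem_filter, Finset.mem_univ, true_and]
  linarith [apply_eq_neg hΔ i istar]

lemma sqNormNeg_pos (hΔ : Δ ∈ Dcw K) {istar i : Fin K} (histar : IsCondorcetWinner Δ istar)
    (hi : i ≠ istar) : 0 < sqNormNeg Δ i := by
  have h := histar i hi
  refine Finset.sum_pos' (fun _ _ => sq_nonneg _) ⟨istar, Finset.mem_univ _, ?_⟩
  have : Δ i istar < 0 := by linarith [apply_eq_neg hΔ i istar]
  rw [min_eq_left this.le]
  exact sq_pos_of_neg this

lemma ceil_sub_one_le {x : ℝ} (hx : 0 ≤ x) : ((⌈x⌉₊ - 1 : ℕ) : ℝ) ≤ x := by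
  rcases Nat.eq_zero_or_pos ⌈x⌉₊ with h | h
  · simpa [h] using hx
  · rw [Nat.cast_pred h]
    linarith [Nat.ceil_lt_add_one hx]

/-- The bound that certifies that a given arm `i` is not the Condorcet winner. -/
lemma exists_budgetProb_certify (hδ0 : 0 < δ) (hδ : δ ≤ 1 / 12) (hA : IsDeltaCorrect A δ)
    (hΔ : Δ ∈ Dcw K) (hties : ∀ i j, i ≠ j → Δ i j ≠ 0) {istar i : Fin K}
    (histar : IsCondorcetWinner Δ istar) (hi : i ≠ istar) :
    ∃ τ : RowPerms Δ, δ ≤ budgetProb A τ.env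
      (1 / 3 * (numNeg Δ i / sqNormNeg Δ i) * Real.log (1 / (6 * δ))) := by
  by_contra! hcon
  set b := 1 / 3 * (numNeg Δ i / sqNormNeg Δ i) * Real.log (1 / (6 * δ)) with hb
  have hn : (0 : ℝ) < numNeg Δ i := by exact_mod_cast numNeg_pos hΔ histar hi
  have hs := sqNormNeg_pos hΔ histar hi
  have hlog : 0 ≤ Real.log (1 / (6 * δ)) := by
    apply Real.log_nonneg
    rw [le_div_iff₀ (by positivity)]; linarith
  have hb0 : 0 ≤ b := by positivity
  obtain ⟨r₀, hr₀, q, hq, hexp, hq'⟩ :=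
    exists_exp_le_affinity hA hΔ hties histar hi 1 ⌈b⌉₊ b
  -- Fewer than `⌈b⌉₊` duels in total cannot contain `⌈b⌉₊` duels informative for `i`.
  have hempty : exploreEvent Δ i ⌈b⌉₊ ⌈b⌉₊ = ∅ := by
    ext ω
    simp only [Set.mem_empty_iff_false, iff_false]
    rintro ⟨t, -, ht, a, -, -, hk⟩
    have h1 : countIn (losingPairs Δ i) (hist ω t) ≤ (hist ω t).length := List.countP_le_length
    have h2 := length_hist_le ω t
    omega
  simp only [hempty, measureReal_empty, mean_const, add_zero] at hq'
  have h2δ : 1 - q < 2 * δ := by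
    have := mean_lt fun σ : Equiv.Perm {j // Δ i j < 0} =>
      hcon (RowPerms.shift 1 i σ)
    linarith
  have hlow : √(6 * δ) ≤ affinity r₀ q := by
    refine le_trans ?_ hexp
    rw [Real.sqrt_eq_rpow, Real.rpow_def_of_pos (by positivity), Real.exp_le_exp]
    have h1 : ((⌈b⌉₊ - 1 : ℕ) : ℝ) * (sqNormNeg Δ i / numNeg Δ i) ≤
        1 / 3 * Real.log (1 / (6 * δ)) := by
      calc _ ≤ b * (sqNormNeg Δ i / numNeg Δ i) :=
            mul_le_mul_of_nonneg_right (ceil_sub_one_le hb0) (by positivity)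
        _ = _ := by rw [hb]; field_simp
    have h2 : Real.log (1 / (6 * δ)) = -Real.log (6 * δ) := by rw [one_div, Real.log_inv]
    rw [h2] at h1 hlog
    linarith
  have h1 : √(r₀ * q) ≤ √δ := Real.sqrt_le_sqrt (by nlinarith [hr₀.1, hr₀.2, hq.1, hq.2])
  have h2 : √((1 - r₀) * (1 - q)) ≤ √(2 * δ) :=
    Real.sqrt_le_sqrt (by nlinarith [hr₀.1, hr₀.2, hq.1, hq.2])
  -- This contradicts `1 + √2 < √6`.
  have h3 : √δ + √(2 * δ) < √(6 * δ) := by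
    rw [Real.sqrt_mul (by norm_num) δ, Real.sqrt_mul (by norm_num) δ]
    have h4 : 0 < √δ := Real.sqrt_pos.2 hδ0
    have h5 : 1 + √2 < √6 := by
      have ha : √2 < 1.42 := by rw [Real.sqrt_lt' (by norm_num)]; norm_num
      have hb : 2.42 < √6 := Real.lt_sqrt_of_sq_lt (by norm_num)
      linarith
    nlinarith
  rw [affinity] at hlow
  linarith

lemma sqrt_mul_le_weighted {u v l : ℝ} (hu : 0 ≤ u) (hv : 0 ≤ v) (hl : 0 < l) :
    √(u * v) ≤ (l * u + v / l) / 2 := by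
  apply Real.sqrt_le_iff.2
  refine ⟨by positivity, ?_⟩
  have : u * v = (l * u) * (v / l) := by field_simp
  rw [this]
  nlinarith [sq_nonneg (l * u - v / l)]

/-- Two Bernoulli laws with affinity at least `13/15`, the first with parameter at most `1/12`: the
parameter of the second is at most `11/20`. -/
lemma le_one_sub_of_affinity {r₀ q : ℝ} (hr0 : 0 ≤ r₀) (hr : r₀ ≤ 1 / 12)
    (hq : q ∈ Set.Icc (0 : ℝ) 1) (h : 13 / 15 ≤ affinity r₀ q) : 9 / 20 ≤ 1 - q := by
  -- The weights are nearly optimal at the extreme case `r₀ = 1/12`, `q = 11/20`.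
  have h1 := sqrt_mul_le_weighted hr0 hq.1 (show (0 : ℝ) < 2.57 by norm_num)
  have h2 := sqrt_mul_le_weighted (show 0 ≤ 1 - r₀ by linarith) (sub_nonneg.2 hq.2)
    (show (0 : ℝ) < 0.7 by norm_num)
  rw [affinity] at h
  norm_num at h1 h2
  linarith

/-- The number of informative duels that the exploration bound requires from arm `i`. The factor
`1/10` balances it against the probability of that many duels. -/
def exploreCount (Δ : Matrix (Fin K) (Fin K) ℝ) (i : Fin K) : ℝ :=
  1 / 10 * (numNeg Δ i / sqNormNeg Δ i)

/-- If the budget is small in every environment, then on average over the environments every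
suboptimal arm undergoes many informative duels. -/
lemma mean_exploreEvent_ge (hδ : δ ≤ 1 / 12) (hA : IsDeltaCorrect A δ)
    (hΔ : Δ ∈ Dcw K) (hties : ∀ i j, i ≠ j → Δ i j ≠ 0) {istar i : Fin K}
    (histar : IsCondorcetWinner Δ istar) (hi : i ≠ istar) {b : ℝ}
    (hcon : ∀ τ : RowPerms Δ, budgetProb A τ.env b < δ) :
    7 / 25 ≤ mean fun τ : RowPerms Δ =>
      (law A τ.env).real (exploreEvent Δ i ⌈exploreCount Δ i⌉₊ ⌈b⌉₊) := by
  have hnum : (0 : ℝ) < numNeg Δ i := by exact_mod_cast numNeg_pos hΔ histar hi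
  have hs := sqNormNeg_pos hΔ histar hi
  have hx0 : 0 ≤ exploreCount Δ i := by unfold exploreCount; positivity
  have hone (τ : RowPerms Δ) : 7 / 25 ≤ mean fun σ : Equiv.Perm {j // Δ i j < 0} =>
      (law A (τ.shift i σ).env).real (exploreEvent Δ i ⌈exploreCount Δ i⌉₊ ⌈b⌉₊) := by
    obtain ⟨r₀, hr₀, q, hq, hexp, hq'⟩ :=
      exists_exp_le_affinity hA hΔ hties histar hi τ ⌈exploreCount Δ i⌉₊ b
    have h1 : 13 / 15 ≤ affinity r₀ q := by
      refine le_trans ?_ hexp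
      have h2 : ((⌈exploreCount Δ i⌉₊ - 1 : ℕ) : ℝ) * (sqNormNeg Δ i / numNeg Δ i) ≤ 1 / 10 := by
        calc _ ≤ exploreCount Δ i * (sqNormNeg Δ i / numNeg Δ i) :=
              mul_le_mul_of_nonneg_right (ceil_sub_one_le hx0) (by positivity)
          _ = _ := by unfold exploreCount; field_simp
      have h3 := Real.add_one_le_exp
        (-(4 / 3 * (((⌈exploreCount Δ i⌉₊ - 1 : ℕ) : ℝ) * (sqNormNeg Δ i / numNeg Δ i))))
      linarith
    have h2 := le_one_sub_of_affinity hr₀.1 (hr₀.2.trans hδ) hq h1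
    have h3 := mean_lt fun σ : Equiv.Perm {j // Δ i j < 0} =>
      hcon (τ.shift i σ)
    linarith
  have h := mean_mono hone
  rwa [mean_const, RowPerms.mean_mean_shift i fun τ : RowPerms Δ =>
    (law A τ.env).real (exploreEvent Δ i ⌈exploreCount Δ i⌉₊ ⌈b⌉₊)] at h

/-- A duel is informative for at most one arm, so the informative duels share the budget. -/
lemma sum_mul_exploreEvent_le (hΔ : Δ ∈ Dcw K) {Δ' : Matrix (Fin K) (Fin K) ℝ}
    (s : Finset (Fin K)) {x : Fin K → ℝ} {b : ℝ} (hb : 0 ≤ b) :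
    ∑ i ∈ s, x i * (law A Δ').real (exploreEvent Δ i ⌈x i⌉₊ ⌈b⌉₊) ≤ b := by
  classical
  have hm (i : Fin K) : MeasurableSet (exploreEvent Δ i ⌈x i⌉₊ ⌈b⌉₊) :=
    measurableSet_stopEventFrom 0 ⌈b⌉₊ fun h _ => ⌈x i⌉₊ ≤ countIn (losingPairs Δ i) h
  have hint (i : Fin K) : Integrable
      ((exploreEvent Δ i ⌈x i⌉₊ ⌈b⌉₊).indicator fun _ => x i) (law A Δ') :=
    (integrable_const _).indicator (hm i)
  have hpt (ω : ℕ → Round K) :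
      ∑ i ∈ s, (exploreEvent Δ i ⌈x i⌉₊ ⌈b⌉₊).indicator (fun _ => x i) ω ≤ b := by
    by_cases hω : ∃ t < ⌈b⌉₊, ∃ a, (∀ s < t, (ω s).isLeft) ∧ ω t = Sum.inr a
    · obtain ⟨t, ht, a, hl, ha⟩ := hω
      calc _ ≤ ∑ i ∈ s, (countIn (losingPairs Δ i) (hist ω t) : ℝ) := by
            refine Finset.sum_le_sum fun i _ => ?_
            by_cases hmem : ω ∈ exploreEvent Δ i ⌈x i⌉₊ ⌈b⌉₊
            · rw [Set.indicator_of_mem hmem]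
              obtain ⟨t', -, -, a', hl', ha', hk⟩ := hmem
              have htt : t' = t := by
                rcases lt_trichotomy t' t with h | h | h
                · have := hl t' h
                  simp [ha'] at this
                · exact h
                · have := hl' t h
                  simp [ha] at this
              subst htt
              exact (Nat.le_ceil _).trans (by exact_mod_cast hk)
            · rw [Set.indicator_of_notMem hmem]
              positivity
        _ ≤ (t : ℝ) := by
            exact_mod_cast (sum_countIn_losingPairs_le hΔ s _).trans (length_hist_le ω t)
        _ ≤ b := (Nat.lt_ceil.1 ht).le
    · refine le_trans (le_of_eq ?_) hb
      refine Finset.sum_eq_zero fun i _ => Set.indicator_of_notMem ?_ _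
      rintro ⟨t, -, ht, a, hl, ha, -⟩
      exact hω ⟨t, by simpa using ht, a, hl, ha⟩
  calc _ = ∫ ω, ∑ i ∈ s, (exploreEvent Δ i ⌈x i⌉₊ ⌈b⌉₊).indicator (fun _ => x i) ω ∂(law A Δ') := by
        rw [integral_finsetSum _ fun i _ => hint i]
        refine Finset.sum_congr rfl fun i _ => ?_
        rw [integral_indicator_const _ (hm i), smul_eq_mul, mul_comm]
    _ ≤ ∫ _ω, b ∂(law A Δ') :=
        integral_mono (integrable_finsetSum _ fun i _ => hint i) (integrable_const _) hpt
    _ = b := by simp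

/-- The bound on the exploration of all the suboptimal arms. -/
lemma exists_budgetProb_explore (hδ : δ ≤ 1 / 12) (hA : IsDeltaCorrect A δ)
    (hΔ : Δ ∈ Dcw K) (hties : ∀ i j, i ≠ j → Δ i j ≠ 0) {istar : Fin K}
    (histar : IsCondorcetWinner Δ istar) (hK : 2 ≤ K) :
    ∃ τ : RowPerms Δ, δ ≤ budgetProb A τ.env (1 / (37 * Real.log (2 * K)) *
      ∑ i ∈ Finset.univ.erase istar, numNeg Δ i / sqNormNeg Δ i) := by
  by_contra! hcon
  set s := Finset.univ.erase istar with hs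
  set X := ∑ i ∈ s, exploreCount Δ i with hX
  have hlog : 50 ≤ 37 * Real.log (2 * K) := by
    have h1 : Real.log 4 ≤ Real.log (2 * K) := by
      apply Real.log_le_log (by norm_num)
      have : (2 : ℝ) ≤ K := by exact_mod_cast hK
      linarith
    have h2 : Real.log 4 = 2 * Real.log 2 := by
      rw [show (4 : ℝ) = 2 ^ 2 by norm_num, Real.log_pow]; norm_num
    linarith [Real.log_two_gt_d9]
  have hpos : ∀ i ∈ s, 0 < exploreCount Δ i := fun i hi => by
    have hi' : i ≠ istar := Finset.ne_of_mem_erase hi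
    have h1 : (0 : ℝ) < numNeg Δ i := by exact_mod_cast numNeg_pos hΔ histar hi'
    have h2 := sqNormNeg_pos hΔ histar hi'
    unfold exploreCount
    positivity
  have hXpos : 0 < X := by
    refine Finset.sum_pos hpos ?_
    rw [hs, ← Finset.card_pos, Finset.card_erase_of_mem (Finset.mem_univ _), Finset.card_univ,
      Fintype.card_fin]
    omega
  have hsum : ∑ i ∈ s, (numNeg Δ i / sqNormNeg Δ i : ℝ) = 10 * X := by
    rw [hX, Finset.mul_sum]
    exact Finset.sum_congr rfl fun i _ => by unfold exploreCount; ring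
  rw [hsum] at hcon
  set b := 1 / (37 * Real.log (2 * K)) * (10 * X) with hb
  have hb0 : 0 ≤ b := by positivity
  have hbX : b ≤ 1 / 50 * (10 * X) :=
    mul_le_mul_of_nonneg_right (one_div_le_one_div_of_le (by norm_num) hlog) (by positivity)
  have h1 : X * (7 / 25) ≤ b := by
    calc _ = ∑ i ∈ s, exploreCount Δ i * (7 / 25) := by rw [Finset.sum_mul]
      _ ≤ ∑ i ∈ s, exploreCount Δ i * mean fun τ : RowPerms Δ =>
            (law A τ.env).real (exploreEvent Δ i ⌈exploreCount Δ i⌉₊ ⌈b⌉₊) :=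
          Finset.sum_le_sum fun i hi => mul_le_mul_of_nonneg_left
            (mean_exploreEvent_ge hδ hA hΔ hties histar (Finset.ne_of_mem_erase hi) hcon)
            (hpos i hi).le
      _ = mean fun τ : RowPerms Δ => ∑ i ∈ s, exploreCount Δ i *
            (law A τ.env).real (exploreEvent Δ i ⌈exploreCount Δ i⌉₊ ⌈b⌉₊) :=
          (mean_sum_mul _ _ _).symm
      _ ≤ mean fun _ : RowPerms Δ => b :=
          mean_mono fun τ => sum_mul_exploreEvent_le hΔ s hb0
      _ = b := mean_const b
  linarith

/-- The permutations may depend on which of the two bounds is the larger. -/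
lemma exists_budgetProb (hδ0 : 0 < δ) (hδ : δ ≤ 1 / 12) (hA : IsDeltaCorrect A δ)
    (hΔ : Δ ∈ Dcw K) (hties : ∀ i j, i ≠ j → Δ i j ≠ 0) {istar : Fin K}
    (histar : IsCondorcetWinner Δ istar) :
    ∃ τ : RowPerms Δ, δ ≤ budgetProb A τ.env (budgetLowerBound δ Δ istar) := by
  rcases lt_or_ge K 2 with hK | hK
  · -- With a single arm, both terms of the bound are empty.
    have : ∀ i, i = istar := fun i => Fin.ext (by omega)
    have he : IsEmpty {i // i ≠ istar} := ⟨fun i => i.2 (this i)⟩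
    have hs : Finset.univ.erase istar = ∅ := by
      ext i; simp [this i]
    refine ⟨1, ?_⟩
    rw [budgetLowerBound, hs, Real.iSup_of_isEmpty]
    simp only [budgetProb, mul_zero, zero_mul, Finset.sum_empty, max_self, ENNReal.ofReal_zero,
      zero_le, Set.ofPred_true, probReal_univ]
    linarith
  · obtain ⟨j, hj⟩ : ∃ j, j ≠ istar := by
      have : Nontrivial (Fin K) := Fin.nontrivial_iff_two_le.2 hK
      exact exists_ne istar
    have : Nonempty {i // i ≠ istar} := ⟨⟨j, hj⟩⟩
    obtain ⟨⟨i, hi⟩, hsup⟩ := exists_eq_ciSup_of_finite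
      (f := fun i : {i // i ≠ istar} => (numNeg Δ i / sqNormNeg Δ i : ℝ))
    rw [budgetLowerBound, ← hsup]
    rcases max_choice (1 / 3 * (numNeg Δ i / sqNormNeg Δ i : ℝ) * Real.log (1 / (6 * δ)))
      (1 / (37 * Real.log (2 * K)) *
        ∑ i ∈ Finset.univ.erase istar, (numNeg Δ i / sqNormNeg Δ i : ℝ)) with h | h
    · rw [h]; exact exists_budgetProb_certify hδ0 hδ hA hΔ hties histar hi
    · rw [h]; exact exists_budgetProb_explore hδ hA hΔ hties histar hK

end DuelingBandit
end

open DuelingBandit in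
theorem theorem4 {K : ℕ} (δ : ℝ) (hδ0 : 0 < δ) (hδ : δ ≤ 1 / 12)
    (A : Algorithm K) (hA : IsDeltaCorrect A δ)
    (Δ : Matrix (Fin K) (Fin K) ℝ) (hΔ : Δ ∈ Dcw K)
    (istar : Fin K) (histar : IsCondorcetWinner Δ istar)
    (hties : ∀ i j, i ≠ j → Δ i j ≠ 0) :
    ∃ Δ' : Matrix (Fin K) (Fin K) ℝ,
      (∃ π : Fin K → Equiv.Perm (Fin K),
        (∀ i j, Δ i j < 0 ↔ Δ i (π i j) < 0) ∧ Δ' = permuteNeg Δ π) ∧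
      (∀ c : ℝ, Δ' ∈ localClass c δ Δ istar) ∧
      (∀ i j, SignType.sign (Δ' i j) = SignType.sign (Δ i j)) ∧
      (∀ i, negEntries Δ' i = negEntries Δ i) ∧
      δ ≤ (law A Δ').real
        {ω | ENNReal.ofReal (budgetLowerBound δ Δ istar) ≤ (budget ω : ENNReal)} := by
  obtain ⟨τ, hτ⟩ := exists_budgetProb hδ0 hδ hA hΔ hties histar
  have hπ := τ.extend_neg_iff
  exact ⟨τ.env, ⟨τ.extend, hπ, rfl⟩, fun c => permuteNeg_mem_localClass hΔ hπ histar c δ,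
    sign_permuteNeg hΔ hπ, negEntries_permuteNeg hΔ hπ, hτ⟩
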